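/- For $n\ge 1$, a permutation $\sigma\in\mathfrak S_n$ is called unimodal if for some $m\in\{1,\dots,n\}$ one has $\sigma(1)<\sigma(2)<\cdots<\sigma(m)>\sigma(m+1)>\cdots>\sigma(n)$. For $k\ge 1$ let $$c_k=\frac1k\sum_{d\mid k,\ d\ \mathrm{odd}}\mu(d)\,2^{k/d-1},$$ where $\mu$ is the Möbius function, and let $u_n^{(k)}$ be the number of unimodal permutations in $\mathfrak S_n$ having no $k$-cycle in their cycle decomposition (fixed points being $1$-cycles). Then, for every $k\ge 1$, $c_k$ is a nonnegative integer and, as formal power series in $t$ with rational coefficients, $$1+2\sum_{n\ge 1}u_n^{(k)}t^n=\left(\frac{1-t^k}{1+t^k}\right)^{c_k}\frac{1}{1-2t}.$$ For example, for every $n\ge 1$ the number of unimodal permutations in $\mathfrak S_n$ without fixed points (unimodal derangements) is $u_n^{(1)}=\frac13\left(2^{n-1}+(-1)^n\right)$. -/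

import Mathlib

/-- A permutation `σ` of `{1, …, n}` (indexed as `Fin n`) is unimodal if for some `m` one has
`σ 1 < σ 2 < ⋯ < σ m > σ (m + 1) > ⋯ > σ n`. -/
def IsUnimodal {n : ℕ} (σ : Equiv.Perm (Fin n)) : Prop :=
  ∃ m : Fin n, StrictMonoOn σ (Set.Iic m) ∧ StrictAntiOn σ (Set.Ici m)

/-- The permutation `σ` has a `k`-cycle: `k` is a part of the partition of `n` that is the cycle
type of `σ`, where fixed points are counted as `1`-cycles. -/
def HasCycleOfLength {n : ℕ} (σ : Equiv.Perm (Fin n)) (k : ℕ) : Prop :=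
  k ∈ σ.partition.parts

/-- The number of unimodal permutations in `S_n` that have no `k`-cycle. -/
noncomputable def numUnimodalNoCycle (n k : ℕ) : ℕ :=
  {σ : Equiv.Perm (Fin n) | IsUnimodal σ ∧ ¬ HasCycleOfLength σ k}.ncard

/-- The rational number `(1 / n) * ∑ μ(d) * 2 ^ (n / d - 1)`, summed over the odd divisors `d`
of `n`. -/
def cycleExponent (n : ℕ) : ℚ :=
  (1 / (n : ℚ)) *
    ∑ d ∈ n.divisors with Odd d, (ArithmeticFunction.moebius d : ℚ) * 2 ^ (n / d - 1)

/-! The proof is symbolic dynamics for the tent map. A unimodal permutation of a nonempty `Fin n`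
carries exactly two tent labellings, since only the label of the peak is free; hence the factor 2,
and it suffices to count tents.

Send a point `a` to its itinerary, the sequence of labels of `a, σ a, σ² a, …`. If `n!` divides `L`,
it lies in the finite set `PeriodicSeq L`, on which the shift is itself a tent for the order by
prefix parities. Itineraries are monotone, and a tent is recovered from the number `N x` of points
with each itinerary `x`. Every shift-invariant `N` of total mass `n` occurs (`IsTent.ncard_tents`).

Cycle lengths can be read off from `N`. If `x` has minimal period `d`, then `σ^d` acts on the points
over `x`, preserving order if the period of `x` has evenly many labels `true` and reversing it
otherwise. In the first case it is the identity; in the second it is the reversal, with at most one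
fixed point and all other points on `2d`-cycles (`IsTent.exists_minimalPeriod_eq_iff`).

The generating function is therefore a product over shift orbits. Without restriction an orbit of
length `d` contributes `1/(1 - t^d)`. Forbidding `k`-cycles multiplies this by `1 - t^k` for even
orbits of length `k`, by `1/(1 + t^k)` for odd orbits of length `k`, by `1 - t^k` for odd orbits of
length `k/2`, and by 1 otherwise. Words of length `k` are equally often even and odd, which forces
the first and third kinds together to be as numerous as the second (`evenPoints_add_halfOddPoints`).
So the correction is `((1 - t^k)/(1 + t^k))^c`, where `c` counts odd orbits of length `k`; Möbius
inversion gives `c = cycleExponent k`. Finally, there are `2^n` tents in all (`ncard_tents_zero`).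
-/

/-- A permutation `σ` of a linear order together with a cut of the order into an initial segment
(label `false`), on which `σ` increases, and a final segment (label `true`), on which `σ`
decreases. -/
structure IsTent {α : Type*} [LinearOrder α] (σ : Equiv.Perm α) (p : α → Bool) : Prop where
  monotone : Monotone p
  strictMonoOn : StrictMonoOn σ {a | p a = false}
  strictAntiOn : StrictAntiOn σ {a | p a = true}

/-! ### Counting order reversals along an orbit -/

/-- The number of points with label `true` among `x, f x, …, f^[r - 1] x`. -/
def flips {X : Type*} (f : X → X) (q : X → Bool) (r : ℕ) (x : X) : ℕ :=
  ∑ j ∈ Finset.range r, (q (f^[j] x)).toNat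

lemma flips_succ {X : Type*} (f : X → X) (q : X → Bool) (r : ℕ) (x : X) :
    flips f q (r + 1) x = flips f q r x + (q (f^[r] x)).toNat :=
  Finset.sum_range_succ _ _

lemma flips_add {X : Type*} (f : X → X) (q : X → Bool) (r s : ℕ) (x : X) :
    flips f q (r + s) x = flips f q r x + flips f q s (f^[r] x) := by
  simp only [flips, Finset.sum_range_add, ← Function.iterate_add_apply, add_comm]

lemma flips_apply {X : Type*} (f : X → X) (q : X → Bool) {r : ℕ} {x : X} (h : f^[r] x = x) :
    flips f q r (f x) = flips f q r x := by
  have h1 := flips_add f q 1 r x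
  have h2 := flips_add f q r 1 x
  rw [h, add_comm r 1] at h2
  simp only [Function.iterate_one] at h1
  omega

lemma flips_mul {X : Type*} (f : X → X) (q : X → Bool) {r : ℕ} {x : X} (h : f^[r] x = x)
    (c : ℕ) : flips f q (r * c) x = c * flips f q r x := by
  induction c with
  | zero => simp [flips]
  | succ c ih =>
    have h' : f^[r * c] x = x := by
      rw [Function.iterate_mul]; exact Function.iterate_fixed h c
    rw [mul_add, mul_one, flips_add, ih, h']; ring

/-! ### Itineraries are monotone -/

section Itinerary

variable {α X : Type*} [LinearOrder α] [LinearOrder X] {σ : Equiv.Perm α} {p : α → Bool}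
  {f : Equiv.Perm X} {q : X → Bool} {ι : α → X}

/-- While the labels of the two points agree, both maps preserve the order or both reverse it, so
the comparison can be pushed forward one step. Once the labels differ, their monotonicity decides
both comparisons alike. -/
lemma IsTent.lt_of_map_lt (hσ : IsTent σ p) (hf : IsTent f q) (hι : Function.Semiconj ι σ f)
    (hq : ∀ a, q (ι a) = p a) (r : ℕ) (a b : α) (hr : q (f^[r] (ι a)) ≠ q (f^[r] (ι b)))
    (hab : ι a < ι b) : a < b := by
  induction r generalizing a b with
  | zero =>
    by_contra! hba
    have h1 := hf.monotone hab.le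
    have h2 := hσ.monotone hba
    rw [← hq, ← hq] at h2
    exact hr (le_antisymm h1 h2)
  | succ r ih =>
    by_cases h0 : p a = p b
    · rw [Function.iterate_succ_apply, Function.iterate_succ_apply, ← hι a, ← hι b] at hr
      cases hb : p b
      · have ha : p a = false := h0.trans hb
        have := hf.strictMonoOn ((hq a).trans ha) ((hq b).trans hb) hab
        rw [← hι a, ← hι b] at this
        exact (hσ.strictMonoOn.lt_iff_lt ha hb).1 (ih _ _ hr this)
      · have ha : p a = true := h0.trans hb
        have := hf.strictAntiOn ((hq a).trans ha) ((hq b).trans hb) hab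
        rw [← hι a, ← hι b] at this
        exact (hσ.strictAntiOn.lt_iff_gt hb ha).1 (ih _ _ hr.symm this)
    · by_contra! hba
      have h1 := hf.monotone hab.le
      have h2 := hσ.monotone hba
      rw [hq, hq] at h1
      exact h0 (le_antisymm h1 h2)

lemma IsTent.monotone_of_semiconj (hσ : IsTent σ p) (hf : IsTent f q)
    (hsep : ∀ x y, (∀ r, q (f^[r] x) = q (f^[r] y)) → x = y)
    (hι : Function.Semiconj ι σ f) (hq : ∀ a, q (ι a) = p a) : Monotone ι := by
  intro a b hab
  by_contra! hlt
  obtain ⟨r, hr⟩ : ∃ r, q (f^[r] (ι b)) ≠ q (f^[r] (ι a)) := by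
    by_contra! h
    exact hlt.ne (hsep _ _ h)
  exact absurd (hσ.lt_of_map_lt hf hι hq r b a hr hlt) (not_lt.2 hab)

end Itinerary

/-! ### Cycle lengths over a given itinerary -/

/-- Points with equal itineraries always share a label, so each visit to `true` reverses their order
and each visit to `false` keeps it; only the parity of the visits matters. -/
lemma IsTent.iterate_lt_iterate {α X : Type*} [LinearOrder α] {σ : Equiv.Perm α}
    {p : α → Bool} {f : Equiv.Perm X} {q : X → Bool} {ι : α → X} (hσ : IsTent σ p) (hι : Function.Semiconj ι σ f)
    (hq : ∀ a, q (ι a) = p a) {a b : α} (hab : a < b) (hx : ι a = ι b) (r : ℕ) :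
    (Even (flips f q r (ι a)) → σ^[r] a < σ^[r] b) ∧
      (Odd (flips f q r (ι a)) → σ^[r] b < σ^[r] a) := by
  induction r with
  | zero => simp [flips, hab]
  | succ r ih =>
    have ha : q (f^[r] (ι a)) = p (σ^[r] a) := by rw [← hq, hι.iterate_right r a]
    have hb : q (f^[r] (ι a)) = p (σ^[r] b) := by rw [← hq, hι.iterate_right r b, hx]
    rw [flips_succ, Function.iterate_succ_apply', Function.iterate_succ_apply']
    cases h : q (f^[r] (ι a))
    · simp only [Bool.toNat_false, add_zero]
      exact ⟨fun he => hσ.strictMonoOn (ha.symm.trans h) (hb.symm.trans h) (ih.1 he),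
        fun ho => hσ.strictMonoOn (hb.symm.trans h) (ha.symm.trans h) (ih.2 ho)⟩
    · simp only [Bool.toNat_true, Nat.even_add_one, Nat.not_even_iff_odd, Nat.odd_add_one,
        Nat.not_odd_iff_even]
      exact ⟨fun ho => hσ.strictAntiOn (hb.symm.trans h) (ha.symm.trans h) (ih.2 ho),
        fun he => hσ.strictAntiOn (ha.symm.trans h) (hb.symm.trans h) (ih.1 he)⟩

lemma StrictMono.eq_self_of_finite {γ : Type*} [LinearOrder γ] [Finite γ] {g : γ → γ}
    (hg : StrictMono g) (a : γ) : g a = a :=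
  le_antisymm (hg.le_id a) (hg.id_le a)

lemma StrictAnti.apply_apply_of_finite {γ : Type*} [LinearOrder γ] [Finite γ] {g : γ → γ}
    (hg : StrictAnti g) (a : γ) : g (g a) = a :=
  (hg.comp hg).eq_self_of_finite a

/-- An order-reversing self-map of a finite chain is an involution with at most one fixed point, and
an involution has as many fixed points modulo 2 as the set has elements. -/
lemma StrictAnti.exists_fixed_iff_odd_card {γ : Type*} [LinearOrder γ] [Fintype γ] {g : γ → γ}
    (hg : StrictAnti g) : (∃ a, g a = a) ↔ Odd (Fintype.card γ) := by
  have hinv : Function.Involutive g := hg.apply_apply_of_finite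
  have hsub : ∀ a b, g a = a → g b = b → a = b := by
    intro a b ha hb
    rcases lt_trichotomy a b with h | h | h
    · have := hg h; rw [ha, hb] at this; exact absurd this h.asymm
    · exact h
    · have := hg h; rw [ha, hb] at this; exact absurd this h.asymm
  have hmod : Fintype.card γ ≡ Fintype.card (Function.fixedPoints g) [MOD 2] :=
    Equiv.Perm.card_fixedPoints_modEq (p := 2) (n := 1) (f := g) (by
      funext a; exact (pow_two (M := Function.End γ) g ▸ hinv a))
  have hle : Fintype.card (Function.fixedPoints g) ≤ 1 :=
    Fintype.card_le_one_iff.2 fun a b => Subtype.ext (hsub _ _ a.2 b.2)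
  have hpos : (∃ a, g a = a) ↔ 0 < Fintype.card (Function.fixedPoints g) := by
    rw [Fintype.card_pos_iff, nonempty_subtype]; rfl
  rw [hpos, Nat.odd_iff, hmod]
  omega

lemma StrictAnti.exists_not_fixed_iff {γ : Type*} [LinearOrder γ] [Fintype γ] {g : γ → γ}
    (hg : StrictAnti g) : (∃ a, g a ≠ a) ↔ 1 < Fintype.card γ := by
  rw [Fintype.one_lt_card_iff]
  constructor
  · rintro ⟨a, ha⟩; exact ⟨_, _, ha⟩
  · rintro ⟨a, b, hab⟩
    by_contra! h
    rcases lt_or_gt_of_ne hab with h' | h'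
    · have := hg h'; rw [h a, h b] at this; exact absurd this h'.asymm
    · have := hg h'; rw [h a, h b] at this; exact absurd this h'.asymm

/-- The condition on the number `r` of points with itinerary `x` under which these points do not
lie on `k`-cycles. -/
def Allowed {X : Type*} (f : X → X) (q : X → Bool) (k : ℕ) (x : X) (r : ℕ) : Prop :=
  (Function.minimalPeriod f x = k → Even (flips f q (Function.minimalPeriod f x) x) → r = 0) ∧
  (Function.minimalPeriod f x = k → Odd (flips f q (Function.minimalPeriod f x) x) → Even r) ∧
  (2 * Function.minimalPeriod f x = k → Odd (flips f q (Function.minimalPeriod f x) x) → r ≤ 1)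

open Function in
-- Every period over `x` is a multiple of `d`, the minimal period of `x`, so all is decided by the
-- return map `σ^d` on the fibre. If it preserves order it is the identity. If it reverses order,
-- points have period `d` or `2 * d`: the former occurs iff the fibre is odd, the latter iff it has
-- at least two points.
lemma IsTent.exists_minimalPeriod_eq_iff {α X : Type*} [LinearOrder α] [Fintype α]
    [Finite X] {σ : Equiv.Perm α} {p : α → Bool}
    {f : Equiv.Perm X} {q : X → Bool} {ι : α → X} (hσ : IsTent σ p)
    (hι : Semiconj ι σ f) (hq : ∀ a, q (ι a) = p a) {k : ℕ} (x : X) :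
    (∃ a, ι a = x ∧ minimalPeriod σ a = k) ↔
      ¬ Allowed f q k x (Nat.card {a // ι a = x}) := by
  have := Fintype.ofFinite {a // ι a = x}
  rw [Nat.card_eq_fintype_card]
  set d := minimalPeriod f x with hd
  have hdpos : 0 < d := minimalPeriod_pos_of_mem_periodicPts
    (f.injective.mem_periodicPts x)
  have hdx : f^[d] x = x := iterate_minimalPeriod
  let g : {a // ι a = x} → {a // ι a = x} := fun a =>
    ⟨σ^[d] a, by rw [hι.iterate_right d a, a.2, hdx]⟩
  have hdvd : ∀ a, ι a = x → d ∣ minimalPeriod σ a := by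
    intro a ha
    apply IsPeriodicPt.minimalPeriod_dvd
    have : ι (σ^[minimalPeriod σ a] a) = ι a := by rw [iterate_minimalPeriod]
    rw [hι.iterate_right, ha] at this
    exact this
  rcases Nat.even_or_odd (flips f q d x) with he | ho
  · have hg : StrictMono g := by
      intro a b hab
      refine (hσ.iterate_lt_iterate hι hq (a := a) (b := b) hab (a.2.trans b.2.symm) d).1 ?_
      rwa [a.2]
    have hper : ∀ a, ι a = x → minimalPeriod σ a = d := by
      intro a ha
      refine Nat.dvd_antisymm (IsPeriodicPt.minimalPeriod_dvd ?_) (hdvd a ha)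
      exact congrArg Subtype.val (hg.eq_self_of_finite ⟨a, ha⟩)
    have ho' := Nat.not_odd_iff_even.2 he
    simp only [Allowed, ← hd, he, ho', false_imp_iff, imp_true_iff, and_true, true_imp_iff,
      Classical.not_imp, Fintype.card_eq_zero_iff, not_isEmpty_iff, nonempty_subtype]
    constructor
    · rintro ⟨a, ha, h⟩; exact ⟨(hper a ha).symm.trans h, a, ha⟩
    · rintro ⟨h, a, ha⟩; exact ⟨a, ha, (hper a ha).trans h⟩
  · have hg : StrictAnti g := by
      intro a b hab
      refine (hσ.iterate_lt_iterate hι hq (a := a) (b := b) hab (a.2.trans b.2.symm) d).2 ?_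
      rwa [a.2]
    have hfix : ∀ a : {a // ι a = x}, g a = a → minimalPeriod σ a = d := fun a ha =>
      Nat.dvd_antisymm (IsPeriodicPt.minimalPeriod_dvd (congrArg Subtype.val ha)) (hdvd a a.2)
    have hnfix : ∀ a : {a // ι a = x}, g a ≠ a → minimalPeriod σ a = 2 * d := by
      intro a ha
      have h2 : minimalPeriod σ a ∣ 2 * d := by
        apply IsPeriodicPt.minimalPeriod_dvd
        rw [two_mul, IsPeriodicPt, IsFixedPt, iterate_add_apply]
        exact congrArg Subtype.val (hg.apply_apply_of_finite a)
      obtain ⟨c, hc⟩ := hdvd a a.2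
      rw [hc, mul_comm 2 d] at h2
      have hc2 : c ∣ 2 := Nat.dvd_of_mul_dvd_mul_left hdpos h2
      rcases (Nat.dvd_prime Nat.prime_two).1 hc2 with rfl | rfl
      · exfalso
        apply ha
        apply Subtype.ext
        have : σ^[minimalPeriod σ (a : α)] a = a := iterate_minimalPeriod
        rwa [hc, mul_one] at this
      · rw [hc, mul_comm]
    have he' := Nat.not_even_iff_odd.2 ho
    simp only [Allowed, ← hd, ho, he', false_imp_iff, imp_true_iff, true_and, true_imp_iff,
      not_and_or, Classical.not_imp, Nat.not_even_iff_odd, not_le]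
    rw [← hg.exists_fixed_iff_odd_card, ← hg.exists_not_fixed_iff]
    constructor
    · rintro ⟨a, ha, h⟩
      by_cases hga : g ⟨a, ha⟩ = ⟨a, ha⟩
      · exact Or.inl ⟨(hfix _ hga).symm.trans h, _, hga⟩
      · exact Or.inr ⟨(hnfix _ hga).symm.trans h, _, hga⟩
    · rintro (⟨h, a, ha⟩ | ⟨h, a, ha⟩)
      · exact ⟨a, a.2, (hfix a ha).trans h⟩
      · exact ⟨a, a.2, (hnfix a ha).trans h⟩

/-! ### Fibre sizes determine the tent -/

/-- Equal fibre sizes make one map a rearrangement of the other, and a tuple has only one sorted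
rearrangement. -/
lemma Monotone.eq_of_card_fiber_eq {n : ℕ} {X : Type*} [PartialOrder X] {g h : Fin n → X}
    (hg : Monotone g) (hh : Monotone h)
    (hcard : ∀ x, Nat.card {a // g a = x} = Nat.card {a // h a = x}) : g = h := by
  let e : ∀ x, {a // g a = x} ≃ {a // h a = x} := fun x =>
    Classical.choice (Finite.card_eq.1 (hcard x))
  let π : Equiv.Perm (Fin n) := Equiv.ofFiberEquiv e
  have hπ : h ∘ π = g := funext fun a => Equiv.ofFiberEquiv_map e a
  have := Tuple.unique_monotone (f := h) (σ := π) (τ := 1) (by rwa [hπ]) hh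
  rw [hπ] at this
  exact this

/-- Both tents have the same itinerary map, hence the same labels. On each fibre `σ⁻¹ ∘ σ'` is then
strictly increasing, because both factors preserve or both reverse order there, so it is the
identity. -/
lemma IsTent.eq_of_card_fiber_eq {n : ℕ} {X : Type*} [LinearOrder X] {f : Equiv.Perm X}
    {q : X → Bool} (hf : IsTent f q)
    (hsep : ∀ x y, (∀ r, q (f^[r] x) = q (f^[r] y)) → x = y)
    {σ σ' : Equiv.Perm (Fin n)} {p p' : Fin n → Bool} (hσ : IsTent σ p) (hσ' : IsTent σ' p')
    {ι ι' : Fin n → X} (hι : Function.Semiconj ι σ f) (hι' : Function.Semiconj ι' σ' f)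
    (hq : ∀ a, q (ι a) = p a) (hq' : ∀ a, q (ι' a) = p' a)
    (hcard : ∀ x, Nat.card {a // ι a = x} = Nat.card {a // ι' a = x}) : σ = σ' ∧ p = p' := by
  obtain rfl : ι = ι' := (hσ.monotone_of_semiconj hf hsep hι hq).eq_of_card_fiber_eq
    (hσ'.monotone_of_semiconj hf hsep hι' hq') hcard
  obtain rfl : p = p' := funext fun a => (hq a).symm.trans (hq' a)
  refine ⟨Equiv.ext fun a => ?_, rfl⟩
  let g : {b // ι b = ι a} → {b // ι b = ι a} := fun b =>
    ⟨σ.symm (σ' b), by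
      apply f.injective
      rw [← hι, Equiv.apply_symm_apply, hι', b.2]⟩
  have hlab : ∀ b : {b // ι b = ι a}, p b = p a := fun b => by rw [← hq, b.2, hq]
  have hσg : ∀ b : {b // ι b = ι a}, σ (g b) = σ' b := fun b => Equiv.apply_symm_apply _ _
  have hg : StrictMono g := by
    intro b c hbc
    have hbc' : (b : Fin n) < c := hbc
    show (g b : Fin n) < g c
    cases ha : p a
    · rw [← hσ.strictMonoOn.lt_iff_lt ((hlab _).trans ha) ((hlab _).trans ha), hσg, hσg]
      exact hσ'.strictMonoOn ((hlab _).trans ha) ((hlab _).trans ha) hbc'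
    · rw [← hσ.strictAntiOn.lt_iff_gt ((hlab _).trans ha) ((hlab _).trans ha), hσg, hσg]
      exact hσ'.strictAntiOn ((hlab _).trans ha) ((hlab _).trans ha) hbc'
  have h1 := hσg ⟨a, rfl⟩
  rwa [hg.eq_self_of_finite] at h1

/-! ### Every invariant function comes from a tent -/

section Blowup

variable {X : Type*}

/-- The linear order obtained from `X` by replacing each `x : X` by `N x` points. -/
abbrev Blowup (N : X → ℕ) : Type _ := {y : X ×ₗ ℕ // (ofLex y).2 < N (ofLex y).1}

/-- The equivalence of `Blowup N` with a sigma type. -/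
def Blowup.equivSigma (N : X → ℕ) : Blowup N ≃ Σ x, Fin (N x) where
  toFun y := ⟨(ofLex y.1).1, (ofLex y.1).2, y.2⟩
  invFun z := ⟨toLex (z.1, z.2), z.2.2⟩
  left_inv _ := rfl
  right_inv _ := rfl

lemma Blowup.card_fiber (N : X → ℕ) (x : X) :
    Nat.card {y : Blowup N // (ofLex y.1).1 = x} = N x := by
  let e : {y : Blowup N // (ofLex y.1).1 = x} ≃ Fin (N x) :=
    { toFun := fun y => ⟨(ofLex y.1.1).2, y.1.2.trans_eq (congrArg N y.2)⟩
      invFun := fun j => ⟨⟨toLex (x, j), j.2⟩, rfl⟩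
      left_inv := by rintro ⟨⟨⟨a, b⟩, h⟩, rfl⟩; rfl
      right_inv := fun _ => rfl }
  rw [Nat.card_congr e, Nat.card_fin]

variable {f : Equiv.Perm X} {q : X → Bool} {N : X → ℕ}

/-- The lift to `Blowup N` of a map `f` that preserves `N`: the fibre over `x` is mapped to the
fibre over `f x`, with the order kept or reversed according to `q x`. -/
def Blowup.map (f : Equiv.Perm X) (q : X → Bool) (hN : ∀ x, N (f x) = N x) (y : Blowup N) :
    Blowup N :=
  ⟨toLex (f (ofLex y.1).1,
    if q (ofLex y.1).1 then N (ofLex y.1).1 - 1 - (ofLex y.1).2 else (ofLex y.1).2), by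
    have := y.2
    simp only [ofLex_toLex, hN]
    split_ifs <;> omega⟩

lemma Blowup.map_injective (hN : ∀ x, N (f x) = N x) :
    Function.Injective (Blowup.map f q hN) := by
  rintro ⟨⟨x, i⟩, hi⟩ ⟨⟨y, j⟩, hj⟩ h
  have h1 := congrArg (fun z : Blowup N => (ofLex z.1).1) h
  have h2 := congrArg (fun z : Blowup N => (ofLex z.1).2) h
  change i < N x at hi
  change j < N y at hj
  change f x = f y at h1
  obtain rfl := f.injective h1
  change (if q x then N x - 1 - i else i) = (if q x then N x - 1 - j else j) at h2
  have : i = j := by split_ifs at h2 <;> omega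
  subst this
  rfl

variable [LinearOrder X]

lemma Blowup.lt_iff {y z : Blowup N} : y < z ↔ (ofLex y.1).1 < (ofLex z.1).1 ∨
    (ofLex y.1).1 = (ofLex z.1).1 ∧ (ofLex y.1).2 < (ofLex z.1).2 :=
  Prod.Lex.lt_iff

lemma IsTent.blowup_map_lt (hf : IsTent f q) (hN : ∀ x, N (f x) = N x) {y z : Blowup N}
    (hyz : y < z) :
    (q (ofLex y.1).1 = false → q (ofLex z.1).1 = false →
      Blowup.map f q hN y < Blowup.map f q hN z) ∧
    (q (ofLex y.1).1 = true → q (ofLex z.1).1 = true →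
      Blowup.map f q hN z < Blowup.map f q hN y) := by
  obtain ⟨⟨x, i⟩, hi⟩ := y
  obtain ⟨⟨y, j⟩, hj⟩ := z
  rw [Blowup.lt_iff] at hyz
  simp only [Blowup.lt_iff]
  change i < N x at hi
  change j < N y at hj
  change x < y ∨ x = y ∧ i < j at hyz
  change (q x = false → q y = false → f x < f y ∨ f x = f y ∧
    (if q x then N x - 1 - i else i) < (if q y then N y - 1 - j else j)) ∧
    (q x = true → q y = true → f y < f x ∨ f y = f x ∧
    (if q y then N y - 1 - j else j) < (if q x then N x - 1 - i else i))
  rcases hyz with hxy | ⟨rfl, hij⟩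
  · exact ⟨fun hx hy => Or.inl (hf.strictMonoOn hx hy hxy),
      fun hx hy => Or.inl (hf.strictAntiOn hx hy hxy)⟩
  · refine ⟨fun hx _ => Or.inr ⟨rfl, ?_⟩, fun hx _ => Or.inr ⟨rfl, ?_⟩⟩
    · simpa [hx] using hij
    · simp only [hx, if_true]; omega

/-- The lift of `f` to the blowup is a tent, and projection to `X` is its itinerary map. Numbering
the blowup increasingly carries it to `Fin n`. -/
lemma IsTent.exists_of_invariant [Fintype X] (hf : IsTent f q) (hN : ∀ x, N (f x) = N x)
    {n : ℕ} (hn : ∑ x, N x = n) :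
    ∃ (σ : Equiv.Perm (Fin n)) (p : Fin n → Bool) (ι : Fin n → X), IsTent σ p ∧
      Function.Semiconj ι σ f ∧ (∀ a, q (ι a) = p a) ∧ ∀ x, Nat.card {a // ι a = x} = N x := by
  have : Fintype (Blowup N) := Fintype.ofEquiv _ (Blowup.equivSigma N).symm
  have hcard : Fintype.card (Blowup N) = n := by
    rw [Fintype.card_congr (Blowup.equivSigma N), Fintype.card_sigma]
    simpa using hn
  let e : Fin n ≃o Blowup N := monoEquivOfFin _ hcard
  let T : Equiv.Perm (Blowup N) :=
    Equiv.ofBijective _ (Finite.injective_iff_bijective.1 (Blowup.map_injective (q := q) hN))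
  let ι : Fin n → X := fun a => (ofLex (e a).1).1
  let σ : Equiv.Perm (Fin n) := e.toEquiv.trans (T.trans e.symm.toEquiv)
  have hσ : ∀ a, e (σ a) = Blowup.map f q hN (e a) := fun a => e.apply_symm_apply _
  refine ⟨σ, fun a => q (ι a), ι, ⟨?_, ?_, ?_⟩, ?_, fun _ => rfl, ?_⟩
  · intro a b hab
    apply hf.monotone
    rcases hab.lt_or_eq with h | rfl
    · rcases Blowup.lt_iff.1 (e.lt_iff_lt.2 h) with h | h
      · exact h.le
      · exact h.1.le
    · exact le_rfl
  · intro a ha b hb hab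
    rw [← e.lt_iff_lt, hσ, hσ]
    exact (hf.blowup_map_lt hN (e.lt_iff_lt.2 hab)).1 ha hb
  · intro a ha b hb hab
    rw [← e.lt_iff_lt, hσ, hσ]
    exact (hf.blowup_map_lt hN (e.lt_iff_lt.2 hab)).2 ha hb
  · intro a
    show (ofLex (e (σ a)).1).1 = _
    rw [hσ]
    rfl
  · intro x
    rw [← Blowup.card_fiber N x]
    exact Nat.card_congr (e.toEquiv.subtypeEquiv fun _ => Iff.rfl)

end Blowup

/-! ### Tents as invariant functions -/

/-- The set of tents on `Fin n` without `k`-cycles. -/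
def tents (n k : ℕ) : Set (Equiv.Perm (Fin n) × (Fin n → Bool)) :=
  {s | IsTent s.1 s.2 ∧ ∀ a, Function.minimalPeriod s.1 a ≠ k}

/-- Tents without `k`-cycles correspond to the invariant functions of total mass `n` with
allowed values. -/
theorem IsTent.ncard_tents {X : Type*} [LinearOrder X] [Fintype X] {f : Equiv.Perm X}
    {q : X → Bool} (hf : IsTent f q)
    (hsep : ∀ x y, (∀ r, q (f^[r] x) = q (f^[r] y)) → x = y) {n : ℕ}
    (hex : ∀ (σ : Equiv.Perm (Fin n)) (p : Fin n → Bool), ∃ ι : Fin n → X,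
      Function.Semiconj ι σ f ∧ ∀ a, q (ι a) = p a) (k : ℕ) :
    (tents n k).ncard =
      {N : X → ℕ | (∀ x, N (f x) = N x) ∧ (∀ x, Allowed f q k x (N x)) ∧
        ∑ x, N x = n}.ncard := by
  choose ι hι hq using hex
  refine Set.ncard_congr (fun s _ x => Nat.card {a // ι s.1 s.2 a = x}) ?_ ?_ ?_
  · rintro ⟨σ, p⟩ ⟨hσ, hk⟩
    refine ⟨fun x => ?_, fun x => ?_, ?_⟩
    · refine (Nat.card_congr (σ.subtypeEquiv fun a => ?_)).symm
      rw [hι σ p a, f.injective.eq_iff]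
    · by_contra h
      obtain ⟨a, -, ha⟩ := (hσ.exists_minimalPeriod_eq_iff (hι σ p) (hq σ p) x).2 h
      exact hk a ha
    · classical
      simp only [Nat.card_eq_fintype_card]
      rw [← Fintype.card_sigma, Fintype.card_congr (Equiv.sigmaFiberEquiv _), Fintype.card_fin]
  · rintro ⟨σ, p⟩ ⟨σ', p'⟩ ⟨hσ, -⟩ ⟨hσ', -⟩ h
    obtain ⟨h1, h2⟩ := hf.eq_of_card_fiber_eq hsep hσ hσ' (hι _ _) (hι _ _) (hq _ _) (hq _ _)
      (fun x => congrFun h x)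
    exact Prod.ext h1 h2
  · rintro N ⟨hN, hA, hn⟩
    obtain ⟨σ, p, ι', hσ, hι', hq', hcard⟩ := hf.exists_of_invariant hN hn
    -- The chosen itinerary map and the projection of the blowup yield the same labels at all times,
    -- so separation identifies them.
    have hιeq : ι σ p = ι' := by
      funext a
      apply hsep
      intro r
      rw [← (hι σ p).iterate_right r a, ← hι'.iterate_right r a, hq, hq']
    refine ⟨(σ, p), ⟨hσ, fun a ha => ?_⟩, ?_⟩
    · exact (hσ.exists_minimalPeriod_eq_iff hι' hq' (ι' a)).1 ⟨a, rfl, ha⟩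
        (by rw [hcard]; exact hA _)
    · funext x
      simp only [hιeq]
      exact hcard x

/-! ### Generating functions as products over orbits -/

open PowerSeries in
lemma PowerSeries.coeff_prod_eq_ncard {O : Type*} [Fintype O] (size : O → ℕ)
    (hsize : ∀ o, 0 < size o) (A : O → ℕ → Prop) [∀ o r, Decidable (A o r)] (n : ℕ) :
    coeff n (∏ o, PowerSeries.mk fun r => if size o ∣ r ∧ A o (r / size o) then (1 : ℚ) else 0) =
      {N : O → ℕ | (∀ o, A o (N o)) ∧ ∑ o, size o * N o = n}.ncard := by
  classical
  rw [coeff_prod]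
  simp only [coeff_mk]
  have h : ∀ l : O →₀ ℕ, (∏ o, if size o ∣ l o ∧ A o (l o / size o) then (1 : ℚ) else 0) =
      if ∀ o, size o ∣ l o ∧ A o (l o / size o) then 1 else 0 := fun l => by
    simp [Finset.prod_ite_zero]
  simp only [h]
  rw [Finset.sum_boole, Nat.cast_inj, ← Set.ncard_coe_finset]
  symm
  refine Set.ncard_congr (fun N _ => Finsupp.equivFunOnFinite.symm fun o => size o * N o) ?_ ?_ ?_
  · rintro N ⟨hA, hn⟩
    simp only [Finset.coe_filter, Finset.mem_finsuppAntidiag, Set.mem_ofPred_eq,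
      Finsupp.coe_equivFunOnFinite_symm]
    exact ⟨⟨hn, Finset.subset_univ _⟩, fun o =>
      ⟨dvd_mul_right _ _, by rw [Nat.mul_div_cancel_left _ (hsize o)]; exact hA o⟩⟩
  · intro N N' _ _ h
    funext o
    have := congrFun (Finsupp.equivFunOnFinite.symm.injective h) o
    exact Nat.eq_of_mul_eq_mul_left (hsize o) this
  · intro l hl
    simp only [Finset.coe_filter, Finset.mem_finsuppAntidiag, Set.mem_ofPred_eq] at hl
    have hm : ∀ o, size o * (l o / size o) = l o := fun o => Nat.mul_div_cancel' (hl.2 o).1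
    refine ⟨fun o => l o / size o, ⟨fun o => (hl.2 o).2, ?_⟩, ?_⟩
    · simp only [hm]; exact hl.1.1
    · ext o; exact hm o

section Orbits

open Function

variable {X : Type*} [Finite X] (f : Equiv.Perm X) (q : X → Bool)

lemma flips_minimalPeriod_apply {X : Type*} (f : Equiv.Perm X) (q : X → Bool) (x : X) :
    flips f q (minimalPeriod f x) (f x) = flips f q (minimalPeriod f x) x :=
  flips_apply _ _ iterate_minimalPeriod

/-- The orbits of a permutation. -/
abbrev CycleOrbit : Type _ := Quotient (Equiv.Perm.SameCycle.setoid f)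

variable {f}

lemma Equiv.Perm.minimalPeriod_pos_of_finite (x : X) : 0 < minimalPeriod f x :=
  minimalPeriod_pos_of_mem_periodicPts (f.injective.mem_periodicPts x)

lemma Equiv.Perm.card_orbit_eq_minimalPeriod (x : X) :
    Nat.card {y // (Quotient.mk _ y : CycleOrbit f) = Quotient.mk _ x} = minimalPeriod f x := by
  have hbij : Bijective (fun j : Fin (minimalPeriod f x) =>
      (⟨f^[j] x, Quotient.sound (s := Equiv.Perm.SameCycle.setoid f) (by
        show f.SameCycle _ _
        rw [Equiv.Perm.iterate_eq_pow]
        exact (Equiv.Perm.sameCycle_pow_left).2 (Equiv.Perm.SameCycle.refl f x))⟩ :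
        {y // (Quotient.mk _ y : CycleOrbit f) = Quotient.mk _ x})) := by
    constructor
    · intro i j h
      exact Fin.ext (iterate_injOn_Iio_minimalPeriod i.2 j.2 (congrArg Subtype.val h))
    · rintro ⟨y, hy⟩
      have hxy : f.SameCycle x y := Equiv.Perm.SameCycle.symm (Quotient.exact hy)
      obtain ⟨i, hi⟩ := hxy.exists_nat_pow_eq
      refine ⟨⟨i % minimalPeriod f x, Nat.mod_lt _ (f.minimalPeriod_pos_of_finite x)⟩,
        Subtype.ext ?_⟩
      show f^[i % minimalPeriod f x] x = y
      rw [iterate_mod_minimalPeriod_eq, Equiv.Perm.iterate_eq_pow, hi]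
  rw [← Nat.card_eq_of_bijective _ hbij, Nat.card_fin]

lemma Equiv.Perm.SameCycle.apply_eq_of_invariant {β : Type*} {N : X → β}
    (hN : ∀ x, N (f x) = N x) {x y : X} (h : f.SameCycle x y) : N x = N y := by
  obtain ⟨i, rfl⟩ := h.exists_nat_pow_eq
  rw [← Equiv.Perm.iterate_eq_pow]
  induction i with
  | zero => rfl
  | succ i ih => rw [iterate_succ_apply', hN]; exact ih ⟨i, by simp⟩

lemma CycleOrbit.apply_out_eq {β : Type*} {N : X → β} (hN : ∀ x, N (f x) = N x) (x : X) :
    N (Quotient.mk _ x : CycleOrbit f).out = N x :=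
  Equiv.Perm.SameCycle.apply_eq_of_invariant hN
    (Quotient.exact (Quotient.out_eq (Quotient.mk _ x : CycleOrbit f)))

lemma CycleOrbit.sum_invariant [Fintype X] [Fintype (CycleOrbit f)] {N : X → ℕ}
    (hN : ∀ x, N (f x) = N x) :
    ∑ x, N x = ∑ o : CycleOrbit f, minimalPeriod f o.out * N o.out := by
  classical
  rw [← Finset.sum_fiberwise Finset.univ (fun x => (Quotient.mk _ x : CycleOrbit f))]
  refine Finset.sum_congr rfl fun o _ => ?_
  rw [← Equiv.Perm.card_orbit_eq_minimalPeriod, Quotient.out_eq, Nat.card_eq_fintype_card,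
    Fintype.card_subtype, ← smul_eq_mul, ← Finset.sum_const]
  refine Finset.sum_congr rfl fun x hx => ?_
  rw [← CycleOrbit.apply_out_eq hN x, (Finset.mem_filter.1 hx).2]

lemma Equiv.Perm.minimalPeriod_apply_self (x : X) : minimalPeriod f (f x) = minimalPeriod f x :=
  minimalPeriod_apply (f.injective.mem_periodicPts x)

lemma Allowed.apply_eq (k : ℕ) (x : X) : Allowed f q k (f x) = Allowed f q k x := by
  funext r
  simp only [Allowed, flips_minimalPeriod_apply, Equiv.Perm.minimalPeriod_apply_self]

lemma Allowed.zero (x : X) (r : ℕ) : Allowed f q 0 x r := by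
  have := (f.minimalPeriod_pos_of_finite x).ne'
  refine ⟨fun h => absurd h this, fun h => absurd h this, fun h => absurd h ?_⟩
  omega

variable (f)

/-- The generating function of the invariant functions with allowed values by total mass. -/
noncomputable def invariantSeries [Fintype X] (k : ℕ) : PowerSeries ℚ :=
  PowerSeries.mk fun n => ({N : X → ℕ | (∀ x, N (f x) = N x) ∧ (∀ x, Allowed f q k x (N x)) ∧
    ∑ x, N x = n}.ncard : ℚ)

open Classical in
/-- The contribution of the orbit of `x` to `invariantSeries`. -/
noncomputable def orbitSeries (k : ℕ) (x : X) : PowerSeries ℚ :=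
  PowerSeries.mk fun r =>
    if minimalPeriod f x ∣ r ∧ Allowed f q k x (r / minimalPeriod f x) then 1 else 0

lemma invariantSeries_eq_prod [Fintype X] [Fintype (CycleOrbit f)] (k : ℕ) :
    invariantSeries f q k = ∏ o : CycleOrbit f, orbitSeries f q k o.out := by
  classical
  ext n
  simp only [orbitSeries, invariantSeries]
  rw [PowerSeries.coeff_prod_eq_ncard (fun o : CycleOrbit f => minimalPeriod f o.out)
    (fun o => f.minimalPeriod_pos_of_finite _) (fun o r => Allowed f q k o.out r),
    PowerSeries.coeff_mk, Nat.cast_inj]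
  refine Set.ncard_congr (fun N _ o => N o.out) ?_ ?_ ?_
  · rintro N ⟨hN, hA, hn⟩
    exact ⟨fun o => hA _, by rw [← hn, CycleOrbit.sum_invariant hN]⟩
  · rintro N N' ⟨hN, -⟩ ⟨hN', -⟩ h
    funext x
    rw [← CycleOrbit.apply_out_eq hN x, ← CycleOrbit.apply_out_eq hN' x]
    exact congrFun h _
  · rintro N ⟨hA, hn⟩
    have hN : ∀ x, N (Quotient.mk _ (f x)) = N (Quotient.mk _ x) := fun x =>
      congrArg N (Quotient.sound (s := Equiv.Perm.SameCycle.setoid f)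
        (Equiv.Perm.sameCycle_apply_left.2 (Equiv.Perm.SameCycle.refl f x)))
    refine ⟨fun x => N (Quotient.mk _ x), ⟨hN, fun x => ?_, ?_⟩, ?_⟩
    · rw [← CycleOrbit.apply_out_eq (f := f) (Allowed.apply_eq q k) x]
      exact hA _
    · rw [CycleOrbit.sum_invariant hN, ← hn]
      simp only [Quotient.out_eq]
    · funext o
      simp only [Quotient.out_eq]

variable {f}

open PowerSeries

/-- Periods are positive, so `k = 0` forbids nothing and the orbit contributes a geometric series.
-/
lemma orbitSeries_zero_mul (x : X) :
    orbitSeries f q 0 x * (1 - PowerSeries.X ^ minimalPeriod f x) = 1 := by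
  have hpos := f.minimalPeriod_pos_of_finite x
  ext n
  simp only [orbitSeries, Allowed.zero, and_true, mul_sub, mul_one, map_sub, coeff_mul_X_pow',
    coeff_mk, coeff_one]
  rcases lt_or_ge n (minimalPeriod f x) with h | h
  · rw [if_neg (not_le.2 h), sub_zero]
    refine if_congr ⟨fun hd => ?_, fun h0 => h0 ▸ dvd_zero _⟩ rfl rfl
    exact Nat.eq_zero_of_dvd_of_lt hd h
  · rw [if_pos h, if_neg (by omega : n ≠ 0), sub_eq_zero]
    exact if_congr ((Nat.dvd_sub_iff_left h dvd_rfl).symm) rfl rfl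

lemma orbitSeries_of_even {k : ℕ} {x : X} (h : minimalPeriod f x = k)
    (he : Even (flips f q (minimalPeriod f x) x)) : orbitSeries f q k x = 1 := by
  have hpos := f.minimalPeriod_pos_of_finite x
  rw [h] at he hpos
  have ho := Nat.not_odd_iff_even.2 he
  ext n
  simp only [orbitSeries, Allowed, he, ho, coeff_mk, coeff_one, h, true_imp_iff, false_imp_iff,
    imp_true_iff, and_true]
  refine if_congr ⟨fun ⟨hd, h0⟩ => ?_, fun h0 => by simp [h0]⟩ rfl rfl
  exact Nat.eq_zero_of_dvd_of_div_eq_zero hd h0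

/-- Only even multiplicities are allowed, so the factor is `1/(1 - t^(2k))`. -/
lemma orbitSeries_of_odd_mul {k : ℕ} {x : X} (h : minimalPeriod f x = k)
    (ho : Odd (flips f q (minimalPeriod f x) x)) :
    orbitSeries f q k x * (1 + PowerSeries.X ^ k) = orbitSeries f q 0 x := by
  have hpos := f.minimalPeriod_pos_of_finite x
  have he := Nat.not_even_iff_odd.2 ho
  rw [h] at ho he
  have h2 : 2 * k ≠ k := by omega
  ext n
  simp only [orbitSeries, Allowed.zero, mul_add, mul_one, map_add, coeff_mul_X_pow', coeff_mk]
  simp only [Allowed, he, ho, h, h2, true_imp_iff, false_imp_iff, imp_true_iff, and_true,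
    true_and]
  rw [h] at hpos
  by_cases hd : k ∣ n
  · obtain ⟨c, rfl⟩ := hd
    rcases Nat.eq_zero_or_pos c with rfl | hc
    · simp [not_le.2 hpos]
    · have e1 : k * c - k = k * (c - 1) := by rw [Nat.mul_sub, mul_one]
      rw [if_pos (Nat.le_mul_of_pos_right k hc), e1]
      simp only [dvd_mul_right, true_and, Nat.mul_div_cancel_left _ hpos, if_true]
      obtain ⟨c, rfl⟩ := Nat.exists_eq_add_of_le' hc
      rw [Nat.add_sub_cancel]
      by_cases hc : Even c <;> simp [Nat.even_add_one, hc]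
  · rw [if_neg (fun h => hd h.1), if_neg hd, zero_add]
    split_ifs with h1 h2
    · exact absurd ((Nat.dvd_sub_iff_left h1 dvd_rfl).1 h2.1) hd
    · rfl
    · rfl

/-- Only multiplicities 0 and 1 are allowed, so the factor is `1 + t^(k/2) = (1 - t^k)/(1 -
t^(k/2))`. -/
lemma orbitSeries_of_two_mul {k : ℕ} {x : X} (h : 2 * minimalPeriod f x = k)
    (ho : Odd (flips f q (minimalPeriod f x) x)) :
    orbitSeries f q k x = orbitSeries f q 0 x * (1 - PowerSeries.X ^ k) := by
  have hpos := f.minimalPeriod_pos_of_finite x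
  have he := Nat.not_even_iff_odd.2 ho
  have h2 : minimalPeriod f x ≠ k := by omega
  have hfac : (1 - PowerSeries.X ^ k : PowerSeries ℚ) =
      (1 - PowerSeries.X ^ minimalPeriod f x) * (1 + PowerSeries.X ^ minimalPeriod f x) := by
    rw [← h]; ring
  rw [hfac, ← mul_assoc, orbitSeries_zero_mul, one_mul]
  ext n
  simp only [orbitSeries, Allowed, he, ho, h, h2, true_imp_iff, false_imp_iff, imp_true_iff,
    true_and, coeff_mk, map_add, coeff_one, coeff_X_pow]
  set d := minimalPeriod f x
  by_cases hd : d ∣ n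
  · obtain ⟨c, rfl⟩ := hd
    rw [Nat.mul_div_cancel_left _ hpos]
    rcases c with _ | _ | c
    · simp [hpos.ne]
    · simp [hpos.ne']
    · have h1 : d * (c + 1 + 1) ≠ d := by nlinarith
      simp [h1, hpos.ne']
  · have h0 : n ≠ 0 := by rintro rfl; exact hd (dvd_zero _)
    have h1 : n ≠ d := by rintro rfl; exact hd dvd_rfl
    simp [hd, h0, h1]

lemma orbitSeries_of_ne {k : ℕ} {x : X} (h1 : minimalPeriod f x ≠ k)
    (h2 : ¬ (2 * minimalPeriod f x = k ∧ Odd (flips f q (minimalPeriod f x) x))) :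
    orbitSeries f q k x = orbitSeries f q 0 x := by
  have hA : ∀ r, Allowed f q k x r := fun r =>
    ⟨fun h => absurd h h1, fun h => absurd h h1, fun h h' => absurd ⟨h, h'⟩ h2⟩
  simp only [orbitSeries, hA, Allowed.zero]

lemma CycleOrbit.card_eq_mul [Fintype (CycleOrbit f)] {P : X → Prop} (hP : ∀ x, P (f x) = P x)
    {d : ℕ} (hd : ∀ x, P x → minimalPeriod f x = d) :
    Nat.card {x // P x} = d * Nat.card {o : CycleOrbit f // P o.out} := by
  classical
  have := Fintype.ofFinite X
  have h := CycleOrbit.sum_invariant (f := f) (N := fun x => if P x then 1 else 0)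
    (fun x => by simp only [hP])
  rw [Nat.card_eq_fintype_card, Nat.card_eq_fintype_card, Fintype.card_subtype,
    Fintype.card_subtype, Finset.card_filter, h, Finset.card_filter, Finset.mul_sum]
  refine Finset.sum_congr rfl fun o _ => ?_
  split_ifs with ho
  · rw [hd _ ho]
  · simp

variable (f)

/-- The number of points of minimal period `d` whose orbit has evenly many labels `true`. -/
noncomputable def evenPoints (d : ℕ) : ℕ :=
  Nat.card {x // minimalPeriod f x = d ∧ Even (flips f q (minimalPeriod f x) x)}

/-- The number of points of minimal period `d` whose orbit has oddly many labels `true`. -/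
noncomputable def oddPoints (d : ℕ) : ℕ :=
  Nat.card {x // minimalPeriod f x = d ∧ Odd (flips f q (minimalPeriod f x) x)}

/-- The number of points of minimal period `d / 2` whose orbit has oddly many labels `true`. -/
noncomputable def halfOddPoints (d : ℕ) : ℕ :=
  Nat.card {x // 2 * minimalPeriod f x = d ∧ Odd (flips f q (minimalPeriod f x) x)}

/-- Dividing `hcount` by `k` turns it into a count of orbits: the `E` and `H` orbits, each gaining a
factor `1 - t^k`, are together as many as the `O` orbits, each gaining `1/(1 + t^k)`. The product
formula is then compared orbit by orbit. -/
lemma exists_invariantSeries_mul [Fintype X] {k : ℕ} (hk : 1 ≤ k)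
    (hcount : evenPoints f q k + 2 * halfOddPoints f q k = oddPoints f q k) :
    ∃ c : ℕ, k * c = oddPoints f q k ∧
      invariantSeries f q k * (1 + PowerSeries.X ^ k) ^ c = invariantSeries f q 0 * (1 - PowerSeries.X ^ k) ^ c := by
  classical
  have : Fintype (CycleOrbit f) := Fintype.ofFinite _
  let E : X → Prop := fun x => minimalPeriod f x = k ∧ Even (flips f q (minimalPeriod f x) x)
  let O : X → Prop := fun x => minimalPeriod f x = k ∧ Odd (flips f q (minimalPeriod f x) x)
  let H : X → Prop := fun x => 2 * minimalPeriod f x = k ∧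
    Odd (flips f q (minimalPeriod f x) x)
  have hE : evenPoints f q k = k * Nat.card {o : CycleOrbit f // E o.out} :=
    CycleOrbit.card_eq_mul (P := E)
      (fun x => by simp only [E, flips_minimalPeriod_apply, Equiv.Perm.minimalPeriod_apply_self])
      fun x h => h.1
  have hO : oddPoints f q k = k * Nat.card {o : CycleOrbit f // O o.out} :=
    CycleOrbit.card_eq_mul (P := O)
      (fun x => by simp only [O, flips_minimalPeriod_apply, Equiv.Perm.minimalPeriod_apply_self])
      fun x h => h.1
  have hH : 2 * halfOddPoints f q k = k * Nat.card {o : CycleOrbit f // H o.out} := by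
    have := CycleOrbit.card_eq_mul (f := f) (P := H) (d := k / 2)
      (fun x => by simp only [H, flips_minimalPeriod_apply, Equiv.Perm.minimalPeriod_apply_self])
      fun x h => by have := h.1; omega
    -- For odd `k` the value `k / 2` is truncated, but then there are no such orbits; a single one
    -- forces `k` to be even.
    rcases isEmpty_or_nonempty {o : CycleOrbit f // H o.out} with he | ⟨o, ho⟩
    · rw [Nat.card_of_isEmpty (α := {o : CycleOrbit f // H o.out}), mul_zero] at this ⊢
      rw [halfOddPoints, this, mul_zero]
    · have h2 : 2 * (k / 2) = k := by have := ho.1; omega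
      rw [halfOddPoints, this, ← mul_assoc, h2]
  have hcard : Nat.card {o : CycleOrbit f // E o.out} + Nat.card {o : CycleOrbit f // H o.out} =
      Nat.card {o : CycleOrbit f // O o.out} := by
    rw [hE, hO, hH, ← mul_add] at hcount
    exact Nat.eq_of_mul_eq_mul_left hk hcount
  refine ⟨_, hO.symm, ?_⟩
  have hpow : ∀ (P : X → Prop) (s : PowerSeries ℚ),
      s ^ Nat.card {o : CycleOrbit f // P o.out} =
        ∏ o : CycleOrbit f, if P o.out then s else 1 := by
    intro P s
    rw [Finset.prod_ite, Finset.prod_const, Finset.prod_const_one, mul_one,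
      Nat.card_eq_fintype_card, Fintype.card_subtype]
  conv_rhs => rw [← hcard, pow_add]
  rw [hpow, hpow, hpow, invariantSeries_eq_prod, invariantSeries_eq_prod,
    ← Finset.prod_mul_distrib, ← Finset.prod_mul_distrib, ← Finset.prod_mul_distrib]
  refine Finset.prod_congr rfl fun o _ => ?_
  have hper := f.minimalPeriod_pos_of_finite o.out
  by_cases h1 : minimalPeriod f o.out = k
  · have hnH : ¬ H o.out := fun h => by have := h.1; omega
    rcases Nat.even_or_odd (flips f q (minimalPeriod f o.out) o.out) with he | ho
    · have hE : E o.out := ⟨h1, he⟩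
      have hnO : ¬ O o.out := fun h => Nat.not_odd_iff_even.2 he h.2
      rw [if_neg hnO, if_pos hE, if_neg hnH, orbitSeries_of_even q h1 he, mul_one, mul_one]
      have := orbitSeries_zero_mul (f := f) q o.out
      rw [h1] at this
      exact this.symm
    · have hO : O o.out := ⟨h1, ho⟩
      have hnE : ¬ E o.out := fun h => Nat.not_odd_iff_even.2 h.2 ho
      rw [if_pos hO, if_neg hnE, if_neg hnH, orbitSeries_of_odd_mul q h1 ho, mul_one, mul_one]
  · rw [if_neg fun h => h1 h.1, if_neg fun h => h1 h.1, mul_one, one_mul]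
    by_cases h2 : H o.out
    · rw [if_pos h2, orbitSeries_of_two_mul q h2.1 h2.2]
    · rw [if_neg h2, orbitSeries_of_ne q h1 h2, mul_one]

end Orbits

open Function

/-! ### Counting periodic points by parity -/

section PointCounts

lemma halfOddPoints_two_mul {X : Type*} (f : Equiv.Perm X) (q : X → Bool) (d : ℕ) : halfOddPoints f q (2 * d) = oddPoints f q d := by
  refine Nat.card_congr (Equiv.subtypeEquivRight fun x => ?_)
  rw [Nat.mul_right_inj two_ne_zero]

lemma halfOddPoints_of_odd {X : Type*} (f : Equiv.Perm X) (q : X → Bool) {d : ℕ}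
    (hd : ¬ Even d) : halfOddPoints f q d = 0 := by
  rw [halfOddPoints, Nat.card_eq_zero]
  left
  exact ⟨fun x => hd (x.2.1 ▸ even_two_mul _)⟩

lemma sum_halfOddPoints {X : Type*} (f : Equiv.Perm X) (q : X → Bool) (k : ℕ)
    (hk : 0 < k) :
    ∑ e ∈ k.divisors, halfOddPoints f q e =
      ∑ e ∈ k.divisors with Even (k / e), oddPoints f q e := by
  rw [← Finset.sum_filter_of_ne (p := fun e => Even e)]
  · symm
    refine Finset.sum_nbij' (fun e => 2 * e) (fun e => e / 2) ?_ ?_ ?_ ?_ ?_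
    · intro e he
      simp only [Finset.mem_filter, Nat.mem_divisors] at he ⊢
      obtain ⟨⟨⟨c, rfl⟩, -⟩, h⟩ := he
      rw [Nat.mul_div_cancel_left _ (Nat.pos_of_mul_pos_right hk)] at h
      obtain ⟨c, rfl⟩ := h.two_dvd
      exact ⟨⟨⟨c, by ring⟩, hk.ne'⟩, even_two_mul _⟩
    · intro e he
      simp only [Finset.mem_filter, Nat.mem_divisors] at he ⊢
      obtain ⟨⟨⟨c, rfl⟩, -⟩, h⟩ := he
      obtain ⟨d, rfl⟩ := h.two_dvd
      have hd : 0 < d := by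
        rcases Nat.eq_zero_or_pos d with rfl | h
        · simp at hk
        · exact h
      rw [Nat.mul_div_cancel_left _ two_pos]
      have e1 : 2 * d * c = d * (2 * c) := by ring
      rw [e1] at hk ⊢
      exact ⟨⟨⟨_, rfl⟩, hk.ne'⟩, by
        rw [Nat.mul_div_cancel_left _ hd]; exact even_two_mul _⟩
    · intro e _
      exact Nat.mul_div_cancel_left _ two_pos
    · intro e he
      exact Nat.two_mul_div_two_of_even (Finset.mem_filter.1 he).2
    · intro e _
      exact (halfOddPoints_two_mul f q e).symm
  · intro e _ h
    by_contra h'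
    exact h (halfOddPoints_of_odd f q h')

variable {X : Type*} [Finite X] (f : Equiv.Perm X) (q : X → Bool)

/-- A point of minimal period `e` runs through its orbit `k / e` times in `k` steps, which
multiplies its count of labels by `k / e`. -/
lemma card_fixed_eq_sum (k : ℕ) (hk : 0 < k) (P : ℕ → Prop) :
    Nat.card {x // f^[k] x = x ∧ P (flips f q k x)} =
      ∑ e ∈ k.divisors, Nat.card {x // minimalPeriod f x = e ∧ P (k / e * flips f q e x)} := by
  classical
  have := Fintype.ofFinite X
  simp only [Nat.card_eq_fintype_card, Fintype.card_subtype]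
  rw [Finset.card_eq_sum_card_fiberwise (f := fun x => minimalPeriod f x) (t := k.divisors)]
  · refine Finset.sum_congr rfl fun e he => congrArg _ ?_
    ext x
    simp only [Finset.mem_filter, Finset.mem_univ, true_and]
    obtain ⟨c, rfl⟩ := Nat.dvd_of_mem_divisors he
    have hpos : 0 < e := Nat.pos_of_mul_pos_right hk
    rw [Nat.mul_div_cancel_left _ hpos]
    constructor
    · rintro ⟨⟨-, hP⟩, rfl⟩
      exact ⟨rfl, by rwa [flips_mul _ _ iterate_minimalPeriod] at hP⟩
    · rintro ⟨rfl, hP⟩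
      refine ⟨⟨?_, by rwa [flips_mul _ _ iterate_minimalPeriod]⟩, rfl⟩
      rw [iterate_mul]
      exact iterate_fixed iterate_minimalPeriod c
  · intro x hx
    simp only [Finset.coe_filter, Finset.mem_univ, true_and, Set.mem_ofPred_eq] at hx
    exact Nat.mem_divisors.2 ⟨IsPeriodicPt.minimalPeriod_dvd hx.1, hk.ne'⟩

lemma card_fixed_odd (k : ℕ) (hk : 0 < k) :
    Nat.card {x // f^[k] x = x ∧ Odd (flips f q k x)} =
      ∑ e ∈ k.divisors with Odd (k / e), oddPoints f q e := by
  rw [card_fixed_eq_sum f q k hk, Finset.sum_filter]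
  refine Finset.sum_congr rfl fun e _ => ?_
  split_ifs with h
  · refine Nat.card_congr (Equiv.subtypeEquivRight fun x => ?_)
    simp only [Nat.odd_mul, h, true_and]
    exact and_congr_right fun hx => by rw [hx]
  · simp [Nat.odd_mul, h]

lemma card_fixed_even (k : ℕ) (hk : 0 < k) :
    Nat.card {x // f^[k] x = x ∧ Even (flips f q k x)} =
      ∑ e ∈ k.divisors, evenPoints f q e +
        ∑ e ∈ k.divisors with Even (k / e), oddPoints f q e := by
  rw [card_fixed_eq_sum f q k hk, Finset.sum_filter, ← Finset.sum_add_distrib]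
  refine Finset.sum_congr rfl fun e _ => ?_
  split_ifs with h
  · classical
    have := Fintype.ofFinite X
    simp only [Nat.even_mul, h, true_or, and_true, evenPoints, oddPoints,
      Nat.card_eq_fintype_card, Fintype.card_subtype]
    rw [← Finset.card_union_of_disjoint]
    · congr 1
      ext x
      simp only [Finset.mem_filter, Finset.mem_union, Finset.mem_univ, true_and, ← and_or_left]
      exact (and_iff_left (Nat.even_or_odd _)).symm
    · rw [Finset.disjoint_filter]
      rintro x - ⟨-, h1⟩ ⟨-, h2⟩
      exact Nat.not_even_iff_odd.2 h2 h1
  · rw [add_zero]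
    refine Nat.card_congr (Equiv.subtypeEquivRight fun x => ?_)
    simp only [Nat.even_mul, h, false_or]
    exact and_congr_right fun hx => by rw [hx]

variable {f q}

/-- Summed over the divisors of `k`, the identity is exactly `hfix`: an odd point of period `e`
counts as even for `f^k` when `k / e` is even, and these points are the ones counted by
`halfOddPoints`. Induction cancels the proper divisors. -/
lemma evenPoints_add_halfOddPoints {L : ℕ}
    (hfix : ∀ k, 0 < k → k ∣ L → Nat.card {x // f^[k] x = x ∧ Even (flips f q k x)} =
      Nat.card {x // f^[k] x = x ∧ Odd (flips f q k x)}) {k : ℕ} (hk : 0 < k) (hkL : k ∣ L) :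
    evenPoints f q k + 2 * halfOddPoints f q k = oddPoints f q k := by
  induction k using Nat.strong_induction_on with
  | _ k ih =>
    have h := hfix k hk hkL
    rw [card_fixed_even f q k hk, card_fixed_odd f q k hk, ← sum_halfOddPoints f q k hk] at h
    have hsplit := Finset.sum_filter_add_sum_filter_not k.divisors (fun e => Even (k / e))
      (oddPoints f q)
    simp only [Nat.not_even_iff_odd] at hsplit
    rw [← sum_halfOddPoints f q k hk] at hsplit
    have hall : ∑ e ∈ k.divisors, (evenPoints f q e + 2 * halfOddPoints f q e) =
        ∑ e ∈ k.divisors, oddPoints f q e := by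
      rw [Finset.sum_add_distrib, ← Finset.mul_sum]
      omega
    rw [← Nat.insert_self_properDivisors hk.ne',
      Finset.sum_insert Nat.self_notMem_properDivisors,
      Finset.sum_insert Nat.self_notMem_properDivisors] at hall
    have hprop : ∑ e ∈ k.properDivisors, (evenPoints f q e + 2 * halfOddPoints f q e) =
        ∑ e ∈ k.properDivisors, oddPoints f q e := by
      refine Finset.sum_congr rfl fun e he => ?_
      have he' := Nat.mem_properDivisors.1 he
      exact ih e he'.2 (Nat.pos_of_dvd_of_pos he'.1 hk) (he'.1.trans hkL)
    omega

/-- With `k = 2^a * m` and `m` odd, the divisors `e` for which `k / e` is odd are the `2^a * i` with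
`i ∣ m`. Möbius inversion over the divisors of `m` applies, whence only odd `d` occur in
`cycleExponent`. -/
lemma oddPoints_eq_mul_cycleExponent {L : ℕ}
    (hfix : ∀ k, 0 < k → k ∣ L →
      Nat.card {x // f^[k] x = x ∧ Odd (flips f q k x)} = 2 ^ (k - 1))
    {k : ℕ} (hk : 0 < k) (hkL : k ∣ L) :
    (oddPoints f q k : ℚ) = k * cycleExponent k := by
  obtain ⟨a, m, hm, rfl⟩ := Nat.exists_eq_two_pow_mul_odd hk.ne'
  have hmpos : 0 < m := hm.pos
  have hodd : ∀ {d : ℕ}, d ∣ m → Odd d := fun h => hm.of_dvd_nat h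
  have hsum : ∀ n > 0, n ∈ {n | n ∣ m} →
      ∑ i ∈ n.divisors, (oddPoints f q (2 ^ a * i) : ℚ) = 2 ^ (2 ^ a * n - 1) := by
    intro n hn hnm
    have hpos : 0 < 2 ^ a * n := by positivity
    have h := hfix (2 ^ a * n) hpos ((Nat.mul_dvd_mul_left _ hnm).trans hkL)
    rw [card_fixed_odd f q _ hpos] at h
    have h' : ((∑ e ∈ (2 ^ a * n).divisors with Odd (2 ^ a * n / e), oddPoints f q e : ℕ) : ℚ) =
        2 ^ (2 ^ a * n - 1) := by rw [h]; push_cast; rfl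
    rw [← h', Nat.cast_sum]
    refine Finset.sum_nbij (fun i => 2 ^ a * i) ?_ ?_ ?_ fun _ _ => rfl
    · intro i hi
      have hi' := Nat.dvd_of_mem_divisors hi
      have hipos := Nat.pos_of_mem_divisors hi
      refine Finset.mem_filter.2 ⟨Nat.mem_divisors.2 ⟨Nat.mul_dvd_mul_left _ hi', hpos.ne'⟩, ?_⟩
      rw [Nat.mul_div_mul_left _ _ (by positivity)]
      exact hodd ((Nat.div_dvd_of_dvd hi').trans hnm)
    · intro i _ j _ hij
      exact Nat.eq_of_mul_eq_mul_left (by positivity) hij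
    · intro e he
      obtain ⟨hd, ho⟩ := Finset.mem_filter.1 (Finset.mem_coe.1 he)
      obtain ⟨c, hc⟩ := Nat.dvd_of_mem_divisors hd
      rw [hc, Nat.mul_div_cancel_left _ (Nat.pos_of_mem_divisors hd)] at ho
      have hcop : Nat.Coprime (2 ^ a) c := Nat.Coprime.pow_left a ho.coprime_two_left
      obtain ⟨i, rfl⟩ := hcop.dvd_of_dvd_mul_right (Dvd.intro _ hc)
      refine ⟨i, Finset.mem_coe.2 (Nat.mem_divisors.2 ⟨⟨c, ?_⟩, hn.ne'⟩), rfl⟩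
      rw [mul_assoc] at hc
      exact Nat.eq_of_mul_eq_mul_left (by positivity) hc
  have hmob := (ArithmeticFunction.sum_eq_iff_sum_mul_moebius_eq_on {n | n ∣ m}
    (fun _ _ h h' => h.trans h')).1 hsum m hmpos dvd_rfl
  rw [Nat.sum_divisorsAntidiagonal (f := fun i j =>
    (ArithmeticFunction.moebius i : ℚ) * 2 ^ (2 ^ a * j - 1))] at hmob
  rw [cycleExponent, ← mul_assoc, mul_one_div_cancel (by exact_mod_cast hk.ne'), one_mul, ← hmob]
  have hdiv : ∀ d, d ∣ 2 ^ a * m → Odd d → d ∣ m := fun d h ho =>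
    (Nat.Coprime.pow_right a ho.coprime_two_right).dvd_of_dvd_mul_left h
  refine Finset.sum_congr ?_ fun d hd => ?_
  · ext d
    simp only [Finset.mem_filter, Nat.mem_divisors]
    constructor
    · rintro ⟨h, -⟩
      exact ⟨⟨h.mul_left _, hk.ne'⟩, hodd h⟩
    · rintro ⟨⟨h, -⟩, ho⟩
      exact ⟨hdiv d h ho, hmpos.ne'⟩
  · obtain ⟨h, ho⟩ := Finset.mem_filter.1 hd
    rw [Nat.mul_div_assoc _ (hdiv d (Nat.dvd_of_mem_divisors h) ho)]

end PointCounts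

/-! ### Words of given parity -/

section WordCount

/-- The first letter is determined by the others. The offset `e` covers both parities: `e = 0`
counts odd words, `e = 1` even ones. -/
lemma card_word_odd (k e : ℕ) :
    Nat.card {w : Fin (k + 1) → Bool // Odd (∑ j, (w j).toNat + e)} = 2 ^ k := by
  have hbij : Bijective (fun w : {w : Fin (k + 1) → Bool // Odd (∑ j, (w j).toNat + e)} =>
      Fin.tail w.1) := by
    constructor
    · rintro ⟨v, hv⟩ ⟨w, hw⟩ h
      have h' : Fin.tail v = Fin.tail w := h
      have ht : ∀ j : Fin k, v j.succ = w j.succ := fun j => congrFun h' j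
      apply Subtype.ext
      show v = w
      rw [← Fin.cons_self_tail v, ← Fin.cons_self_tail w]
      simp only [h']
      rw [Fin.sum_univ_succ] at hv hw
      simp only [ht] at hv
      have : v 0 = w 0 := by
        cases h1 : v 0 <;> cases h2 : w 0 <;> simp only [h1, h2, Bool.toNat_true,
          Bool.toNat_false, reduceCtorEq] at hv hw ⊢ <;> grind
      rw [this]
    · intro u
      by_cases h : Odd (∑ j, (u j).toNat + e)
      · refine ⟨⟨Fin.cons false u, ?_⟩, Fin.tail_cons (α := fun _ => Bool) _ _⟩
        simpa [Fin.sum_univ_succ] using h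
      · refine ⟨⟨Fin.cons true u, ?_⟩, Fin.tail_cons (α := fun _ => Bool) _ _⟩
        simp only [Fin.sum_univ_succ, Fin.cons_zero, Fin.cons_succ, Bool.toNat_true]
        rw [add_assoc, add_comm, Nat.odd_add_one]
        exact h
  rw [Nat.card_eq_of_bijective _ hbij]
  simp

end WordCount

/-! ### The shift on periodic sequences as a universal tent -/

/-- The sequences of period `L`. -/
@[ext]
structure PeriodicSeq (L : ℕ) where
  val : ℕ → Bool
  val_add_period : ∀ i, val (i + L) = val i

namespace PeriodicSeq

variable {L : ℕ}

lemma apply_mod {s : ℕ → Bool} (k : ℕ) (hs : ∀ i, s (i + k) = s i) (i : ℕ) :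
    s (i % k) = s i := by
  have h : ∀ c j, s (j + k * c) = s j := by
    intro c
    induction c with
    | zero => simp
    | succ c ih => intro j; rw [mul_add, mul_one, ← add_assoc, hs, ih]
  conv_rhs => rw [← Nat.mod_add_div i k]
  exact (h _ _).symm

instance [NeZero L] : Finite (PeriodicSeq L) :=
  Finite.of_injective (fun (s : PeriodicSeq L) (j : Fin L) => s.1 j) fun s t h => by
    apply PeriodicSeq.ext
    funext i
    rw [← apply_mod L s.2, ← apply_mod L t.2]
    exact congrFun h ⟨i % L, Nat.mod_lt _ (NeZero.pos L)⟩

/-- The parities of the prefixes of a sequence. -/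
def prefixParity (s : ℕ → Bool) : ℕ → Bool
  | 0 => s 0
  | i + 1 => xor (prefixParity s i) (s (i + 1))

lemma prefixParity_injective : Injective prefixParity := by
  intro s t h
  funext i
  cases i with
  | zero => exact congrFun h 0
  | succ i =>
    have h1 := congrFun h i
    have h2 := congrFun h (i + 1)
    simp only [prefixParity, h1] at h2
    simpa using h2

lemma prefixParity_tail (s : ℕ → Bool) (i : ℕ) :
    prefixParity (fun j => s (j + 1)) i = xor (s 0) (prefixParity s (i + 1)) := by
  induction i with
  | zero => simp [prefixParity]
  | succ i ih => rw [prefixParity, ih]; simp only [prefixParity, Bool.xor_assoc]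

/-- The order of the itineraries of the tent map: the sequences of prefix parities are ordered
lexicographically. -/
noncomputable instance : LinearOrder (PeriodicSeq L) :=
  LinearOrder.lift' (fun s => toLex (prefixParity s.1)) fun _ _ h =>
    PeriodicSeq.ext (prefixParity_injective (toLex.injective h))

lemma lt_iff {s t : PeriodicSeq L} : s < t ↔
    ∃ i, (∀ j < i, prefixParity s.1 j = prefixParity t.1 j) ∧
      prefixParity s.1 i < prefixParity t.1 i :=
  Iff.rfl

variable [NeZero L]

/-- The shift of periodic sequences. -/
def shift (L : ℕ) [NeZero L] : Equiv.Perm (PeriodicSeq L) where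
  toFun s := ⟨fun i => s.1 (i + 1), fun i => by
    rw [← s.2 (i + 1), add_right_comm]⟩
  invFun s := ⟨fun i => s.1 (i + (L - 1)), fun i => by
    rw [← s.2 (i + (L - 1)), add_right_comm]⟩
  left_inv s := PeriodicSeq.ext <| funext fun i => by
    show s.1 (i + (L - 1) + 1) = s.1 i
    rw [add_assoc, Nat.sub_add_cancel (NeZero.pos L), s.2]
  right_inv s := PeriodicSeq.ext <| funext fun i => by
    show s.1 (i + 1 + (L - 1)) = s.1 i
    rw [add_assoc, Nat.add_sub_cancel' (NeZero.pos L), s.2]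

lemma shift_iterate_apply (s : PeriodicSeq L) (r i : ℕ) :
    ((shift L)^[r] s).1 i = s.1 (i + r) := by
  induction r generalizing s with
  | zero => rfl
  | succ r ih =>
    rw [iterate_succ_apply, ih]
    show s.1 (i + r + 1) = _
    rfl

lemma eq_of_labels (s t : PeriodicSeq L)
    (h : ∀ r, ((shift L)^[r] s).1 0 = ((shift L)^[r] t).1 0) : s = t := by
  apply PeriodicSeq.ext
  funext r
  simpa [shift_iterate_apply] using h r

/-- Deleting the first letter complements all later prefix parities if that letter is `true` and
leaves them alone otherwise. So among sequences with the same first letter the shift reverses or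
preserves the lexicographic order. -/
lemma isTent_shift (L : ℕ) [NeZero L] : IsTent (shift L) (fun s => s.1 0) := by
  have hstep : ∀ {s t : PeriodicSeq L}, s < t → s.1 0 = t.1 0 →
      ∃ i, (∀ j < i, prefixParity s.1 (j + 1) = prefixParity t.1 (j + 1)) ∧
        prefixParity s.1 (i + 1) < prefixParity t.1 (i + 1) := by
    intro s t hst h0
    obtain ⟨i, hi, hlt⟩ := lt_iff.1 hst
    cases i with
    | zero => exact absurd hlt (by simp only [prefixParity, h0, lt_irrefl, not_false_iff])
    | succ i => exact ⟨i, fun j hj => hi _ (by omega), hlt⟩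
  have hsh : ∀ (s : PeriodicSeq L) (i : ℕ), prefixParity (shift L s).1 i =
      xor (s.1 0) (prefixParity s.1 (i + 1)) := fun s i => prefixParity_tail s.1 i
  refine ⟨?_, ?_, ?_⟩
  · intro s t hst
    rcases hst.lt_or_eq with h | rfl
    · obtain ⟨i, hi, hlt⟩ := lt_iff.1 h
      cases i with
      | zero => exact hlt.le
      | succ i => exact (hi 0 (Nat.succ_pos _)).le
    · exact le_rfl
  · intro s hs t ht hst
    have hs' : s.1 0 = false := hs
    have ht' : t.1 0 = false := ht
    obtain ⟨i, hi, hlt⟩ := hstep hst (hs'.trans ht'.symm)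
    refine lt_iff.2 ⟨i, fun j hj => ?_, ?_⟩
    · rw [hsh, hsh, hs', ht', hi j hj]
    · rw [hsh, hsh, hs', ht']; simpa using hlt
  · intro s hs t ht hst
    have hs' : s.1 0 = true := hs
    have ht' : t.1 0 = true := ht
    obtain ⟨i, hi, hlt⟩ := hstep hst (hs'.trans ht'.symm)
    refine lt_iff.2 ⟨i, fun j hj => ?_, ?_⟩
    · rw [hsh, hsh, hs', ht', hi j hj]
    · rw [hsh, hsh, hs', ht']
      revert hlt
      generalize prefixParity s.1 (i + 1) = a
      generalize prefixParity t.1 (i + 1) = b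
      revert a b
      decide

lemma exists_itinerary {n : ℕ} (hn : n.factorial ∣ L) (σ : Equiv.Perm (Fin n))
    (p : Fin n → Bool) :
    ∃ ι : Fin n → PeriodicSeq L, Semiconj ι σ (shift L) ∧ ∀ a, (ι a).1 0 = p a := by
  -- The order of `σ` divides `n!`, so every itinerary has period `L`.
  have hσ : σ^[L] = id := by
    obtain ⟨c, rfl⟩ := hn
    have h := pow_card_eq_one (x := σ)
    rw [Fintype.card_perm, Fintype.card_fin] at h
    rw [Equiv.Perm.iterate_eq_pow, pow_mul, h, one_pow]
    rfl
  refine ⟨fun a => ⟨fun i => p (σ^[i] a), fun i => ?_⟩, fun a => ?_, fun a => rfl⟩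
  · show p (σ^[i + L] a) = p (σ^[i] a)
    rw [iterate_add_apply, hσ, id]
  · rfl

lemma flips_shift (s : PeriodicSeq L) (r : ℕ) :
    flips (shift L) (fun s => s.1 0) r s = ∑ j : Fin r, (s.1 j).toNat := by
  rw [flips, Finset.sum_range]
  simp only [shift_iterate_apply, zero_add]

lemma card_fixed_shift {k : ℕ} (hk : 0 < k) (hkL : k ∣ L) (P : ℕ → Prop) :
    Nat.card {s : PeriodicSeq L // (shift L)^[k] s = s ∧
      P (flips (shift L) (fun s => s.1 0) k s)} =
      Nat.card {w : Fin k → Bool // P (∑ j, (w j).toNat)} := by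
  have hfix : ∀ s : PeriodicSeq L, (shift L)^[k] s = s ↔ ∀ i, s.1 (i + k) = s.1 i := by
    intro s
    rw [PeriodicSeq.ext_iff, funext_iff]
    simp only [shift_iterate_apply]
  refine Nat.card_eq_of_bijective
    (fun s => ⟨fun j => s.1.1 j, by rw [← flips_shift]; exact s.2.2⟩) ⟨?_, ?_⟩
  · rintro ⟨s, hs, hs'⟩ ⟨t, ht, ht'⟩ h
    apply Subtype.ext
    apply PeriodicSeq.ext
    funext i
    show s.1 i = t.1 i
    rw [← apply_mod k ((hfix s).1 hs) i, ← apply_mod k ((hfix t).1 ht) i]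
    exact congrFun (congrArg Subtype.val h) ⟨i % k, Nat.mod_lt _ hk⟩
  · rintro ⟨w, hw⟩
    obtain ⟨c, hc⟩ := hkL
    let s : PeriodicSeq L := ⟨fun i => w ⟨i % k, Nat.mod_lt _ hk⟩, fun i => by
      simp only [hc, Nat.add_mul_mod_self_left]⟩
    have hs : ∀ j : Fin k, s.1 j = w j := fun j => by
      simp only [s, Nat.mod_eq_of_lt j.2]
    refine ⟨⟨s, (hfix s).2 fun i => ?_, ?_⟩, ?_⟩
    · simp only [s, Nat.add_mod_right]
    · rw [flips_shift]; simpa only [hs] using hw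
    · exact Subtype.ext (funext hs)

lemma card_fixed_shift_odd {k : ℕ} (hk : 0 < k) (hkL : k ∣ L) :
    Nat.card {s : PeriodicSeq L // (shift L)^[k] s = s ∧
      Odd (flips (shift L) (fun s => s.1 0) k s)} = 2 ^ (k - 1) := by
  rw [card_fixed_shift hk hkL Odd]
  obtain ⟨k, rfl⟩ := Nat.exists_eq_succ_of_ne_zero hk.ne'
  exact card_word_odd k 0

lemma card_fixed_shift_even {k : ℕ} (hk : 0 < k) (hkL : k ∣ L) :
    Nat.card {s : PeriodicSeq L // (shift L)^[k] s = s ∧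
      Even (flips (shift L) (fun s => s.1 0) k s)} = 2 ^ (k - 1) := by
  rw [card_fixed_shift hk hkL Even]
  obtain ⟨k, rfl⟩ := Nat.exists_eq_succ_of_ne_zero hk.ne'
  have := card_word_odd k 1
  simp only [Nat.odd_add_one, Nat.not_odd_iff_even] at this
  exact this

open PowerSeries in
/-- The relation between the generating functions of tents with and without `k`-cycles. -/
theorem exists_coeff_tents_eq {k : ℕ} (hk : 1 ≤ k) (hkL : k ∣ L) :
    ∃ c : ℕ, (c : ℚ) = cycleExponent k ∧ ∃ V U : PowerSeries ℚ,
      (∀ n, n.factorial ∣ L → coeff n V = (tents n k).ncard) ∧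
      (∀ n, n.factorial ∣ L → coeff n U = (tents n 0).ncard) ∧
      V * (1 + X ^ k) ^ c = U * (1 - X ^ k) ^ c := by
  have := Fintype.ofFinite (PeriodicSeq L)
  have hcount := evenPoints_add_halfOddPoints (f := shift L) (q := fun s => s.1 0) (L := L)
    (fun k hk hkL => (card_fixed_shift_even hk hkL).trans (card_fixed_shift_odd hk hkL).symm)
    hk hkL
  obtain ⟨c, hc, hV⟩ := exists_invariantSeries_mul (shift L) (fun s => s.1 0) hk hcount
  refine ⟨c, ?_, _, _, ?_, ?_, hV⟩
  · have h := oddPoints_eq_mul_cycleExponent (f := shift L) (q := fun s => s.1 0) (L := L)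
      (fun k hk hkL => card_fixed_shift_odd hk hkL) hk hkL
    rw [← hc, Nat.cast_mul] at h
    exact mul_left_cancel₀ (Nat.cast_ne_zero.2 (by omega)) h
  · intro n hn
    rw [(isTent_shift L).ncard_tents eq_of_labels (exists_itinerary hn), invariantSeries,
      coeff_mk]
  · intro n hn
    rw [(isTent_shift L).ncard_tents eq_of_labels (exists_itinerary hn), invariantSeries,
      coeff_mk]

end PeriodicSeq

/-! ### There are `2^n` tents -/

section TentCount

variable {n : ℕ}

/-- The key by which the values of a tent are sorted: increasing values come first. -/
def tentKey (μ : Fin n → Bool) (v : Fin n) : Bool ×ₗ ℤ :=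
  toLex (μ v, if μ v then -((v : ℕ) : ℤ) else ((v : ℕ) : ℤ))

lemma tentKey_lt_iff (μ : Fin n → Bool) (v w : Fin n) : tentKey μ v < tentKey μ w ↔
    μ v < μ w ∨ μ v = μ w ∧ (if μ v then w < v else v < w) := by
  rw [tentKey, tentKey, Prod.Lex.lt_iff]
  refine or_congr Iff.rfl (and_congr_right fun h => ?_)
  have h' : μ v = μ w := h
  simp only [ofLex_toLex, ← h']
  split_ifs
  · rw [neg_lt_neg_iff, Nat.cast_lt, Fin.lt_def]
  · rw [Nat.cast_lt, Fin.lt_def]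

lemma tentKey_injective (μ : Fin n → Bool) : Injective (tentKey μ) := by
  intro v w h
  by_contra hne
  have h1 : ¬ tentKey μ v < tentKey μ w := by rw [h]; exact lt_irrefl _
  have h2 : ¬ tentKey μ w < tentKey μ v := by rw [h]; exact lt_irrefl _
  have h3 : μ v = μ w := congrArg (fun z => (ofLex z).1) h
  rw [tentKey_lt_iff] at h1 h2
  rw [h3] at h1 h2
  rcases lt_or_gt_of_ne hne with h' | h' <;> cases hw : μ w <;> simp [hw, h'] at h1 h2

/-- The labels are carried over to the values. A tent lists the `false` values upwards and then the
`true` values downwards, which is the order of the keys. -/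
lemma isTent_iff_strictMono (σ : Equiv.Perm (Fin n)) (μ : Fin n → Bool) :
    IsTent σ (μ ∘ σ) ↔ StrictMono (tentKey μ ∘ σ) := by
  constructor
  · intro h a b hab
    rw [comp_apply, comp_apply, tentKey_lt_iff]
    have hm : μ (σ a) ≤ μ (σ b) := h.monotone hab.le
    rcases hm.lt_or_eq with h1 | h1
    · exact Or.inl h1
    · refine Or.inr ⟨h1, ?_⟩
      split_ifs with h2
      · exact h.strictAntiOn h2 (h1.symm.trans h2) hab
      · have h2' := Bool.eq_false_of_not_eq_true h2
        exact h.strictMonoOn h2' (h1.symm.trans h2') hab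
  · intro h
    have h' : ∀ {a b}, a < b → _ := fun {a b} hab => (tentKey_lt_iff μ (σ a) (σ b)).1 (h hab)
    refine ⟨fun a b hab => ?_, fun a ha b hb hab => ?_, fun a ha b hb hab => ?_⟩
    · rcases hab.lt_or_eq with hab | rfl
      · rcases h' hab with h1 | h1
        · exact h1.le
        · exact h1.1.le
      · exact le_rfl
    · have ha' : μ (σ a) = false := ha
      have hb' : μ (σ b) = false := hb
      simpa [ha', hb'] using h' hab
    · have ha' : μ (σ a) = true := ha
      have hb' : μ (σ b) = true := hb
      simpa [ha', hb'] using h' hab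

/-- Any labelling `μ` of the values comes from exactly one tent, the one that sorts the values by
`tentKey μ`. -/
lemma ncard_tents_zero (n : ℕ) : (tents n 0).ncard = 2 ^ n := by
  have hcomp : ∀ (σ : Equiv.Perm (Fin n)) (p : Fin n → Bool), (p ∘ σ.symm) ∘ σ = p :=
    fun σ p => funext fun a => congrArg p (σ.symm_apply_apply a)
  have h : (tents n 0).ncard = (Set.univ : Set (Fin n → Bool)).ncard := by
    refine Set.ncard_congr (fun s _ => s.2 ∘ s.1.symm) (fun _ _ => Set.mem_univ _) ?_ ?_
    · rintro ⟨σ, p⟩ ⟨σ', p'⟩ ⟨hσ, -⟩ ⟨hσ', -⟩ h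
      change p ∘ σ.symm = p' ∘ σ'.symm at h
      change IsTent σ p at hσ
      change IsTent σ' p' at hσ'
      rw [← hcomp σ p, isTent_iff_strictMono] at hσ
      rw [← hcomp σ' p', isTent_iff_strictMono, ← h] at hσ'
      have h1 := Tuple.unique_monotone hσ.monotone hσ'.monotone
      obtain rfl : σ = σ' := Equiv.ext fun a => tentKey_injective _ (congrFun h1 a)
      rw [← hcomp σ p, h, hcomp]
    · intro μ _
      refine ⟨(Tuple.sort (tentKey μ), μ ∘ Tuple.sort (tentKey μ)), ⟨?_, fun a => ?_⟩, ?_⟩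
      · rw [isTent_iff_strictMono]
        exact (Tuple.monotone_sort _).strictMono_of_injective
          ((tentKey_injective μ).comp (Equiv.injective _))
      · exact (Equiv.Perm.minimalPeriod_pos_of_finite _).ne'
      · funext v
        exact congrArg μ (Equiv.apply_symm_apply _ v)
  rw [h, Set.ncard_univ]
  simp

end TentCount

/-! ### Two tents for each unimodal permutation -/

section Unimodal

lemma IsTent.eq_false_of_le {α : Type*} [LinearOrder α] {σ : Equiv.Perm α} {p : α → Bool}
    (h : IsTent σ p) {a b : α} (hab : a ≤ b) (hb : p b = false) : p a = false := by
  have := h.monotone hab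
  rw [hb] at this
  exact le_bot_iff.1 this

lemma IsTent.eq_true_of_le {α : Type*} [LinearOrder α] {σ : Equiv.Perm α} {p : α → Bool}
    (h : IsTent σ p) {a b : α} (hab : a ≤ b) (ha : p a = true) : p b = true := by
  have := h.monotone hab
  rw [ha] at this
  exact top_le_iff.1 this

lemma IsTent.isUnimodal {n : ℕ} [NeZero n] {σ : Equiv.Perm (Fin n)} {p : Fin n → Bool}
    (h : IsTent σ p) : IsUnimodal σ := by
  obtain ⟨m, hm⟩ : ∃ m, ∀ a, σ a ≤ σ m := Finite.exists_max σ
  have hlt : ∀ {a}, a ≠ m → σ a < σ m := fun ha =>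
    lt_of_le_of_ne (hm _) fun h => ha (σ.injective h)
  refine ⟨m, fun a _ b hb hab => ?_, fun a ha b _ hab => ?_⟩
  · rcases (Set.mem_Iic.1 hb).lt_or_eq with hb | rfl
    · cases hpb : p b
      · have hpa : p a = false := h.eq_false_of_le hab.le hpb
        exact h.strictMonoOn hpa hpb hab
      · have hpm : p m = true := h.eq_true_of_le hb.le hpb
        exact absurd (h.strictAntiOn hpb hpm hb) (not_lt.2 (hm b))
    · exact hlt hab.ne
  · rcases (Set.mem_Ici.1 ha).lt_or_eq with ha | rfl
    · cases hpa : p a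
      · have hpm : p m = false := h.eq_false_of_le ha.le hpa
        exact absurd (h.strictMonoOn hpm hpa ha) (not_lt.2 (hm a))
      · have hpb : p b = true := h.eq_true_of_le hab.le hpa
        exact h.strictAntiOn hpa hpb hab
    · exact hlt hab.ne'

lemma isTent_lt_of_peak {n : ℕ} {σ : Equiv.Perm (Fin n)} {m : Fin n}
    (h1 : StrictMonoOn σ (Set.Iic m)) (h2 : StrictAntiOn σ (Set.Ici m)) :
    IsTent σ fun a => decide (m < a) := by
  refine ⟨fun a b hab => ?_, h1.mono fun a ha => ?_, h2.mono fun a ha => ?_⟩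
  · rw [Bool.le_iff_imp, decide_eq_true_iff, decide_eq_true_iff]
    exact fun h => h.trans_le hab
  · exact not_lt.1 (of_decide_eq_false ha)
  · exact (of_decide_eq_true ha).le

lemma isTent_le_of_peak {n : ℕ} {σ : Equiv.Perm (Fin n)} {m : Fin n}
    (h1 : StrictMonoOn σ (Set.Iic m)) (h2 : StrictAntiOn σ (Set.Ici m)) :
    IsTent σ fun a => decide (m ≤ a) := by
  refine ⟨fun a b hab => ?_, h1.mono fun a ha => ?_, h2.mono fun a ha => ?_⟩
  · rw [Bool.le_iff_imp, decide_eq_true_iff, decide_eq_true_iff]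
    exact fun h => h.trans hab
  · exact (not_le.1 (of_decide_eq_false ha)).le
  · exact of_decide_eq_true ha

/-- A `true` before the peak or a `false` after it would spread to the peak by monotonicity and
contradict the direction of `σ` there. -/
lemma IsTent.eq_lt_or_eq_le {n : ℕ} {σ : Equiv.Perm (Fin n)} {p : Fin n → Bool}
    (h : IsTent σ p) {m : Fin n} (h1 : StrictMonoOn σ (Set.Iic m))
    (h2 : StrictAntiOn σ (Set.Ici m)) :
    p = (fun a => decide (m < a)) ∨ p = fun a => decide (m ≤ a) := by
  have hlow : ∀ a < m, p a = false := by
    intro a ha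
    by_contra hp
    have hpa := Bool.eq_true_of_not_eq_false hp
    have hpm : p m = true := h.eq_true_of_le ha.le hpa
    exact (h.strictAntiOn hpa hpm ha).asymm (h1 ha.le (Set.mem_Iic.2 le_rfl) ha)
  have hhigh : ∀ a > m, p a = true := by
    intro a ha
    by_contra hp
    have hpa := Bool.eq_false_of_not_eq_true hp
    have hpm : p m = false := h.eq_false_of_le ha.le hpa
    exact (h.strictMonoOn hpm hpa ha).asymm (h2 (Set.mem_Ici.2 le_rfl) ha.le ha)
  cases hm : p m
  · left
    funext a
    rcases lt_trichotomy a m with ha | rfl | ha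
    · simp [hlow a ha, ha.le]
    · simp [hm]
    · simp [hhigh a ha, ha]
  · right
    funext a
    rcases lt_trichotomy a m with ha | rfl | ha
    · simp [hlow a ha, ha]
    · simp [hm]
    · simp [hhigh a ha, ha.le]

lemma ncard_tents_eq_two_mul {n : ℕ} [NeZero n] (k : ℕ) :
    (tents n k).ncard =
      2 * {σ : Equiv.Perm (Fin n) | IsUnimodal σ ∧ ∀ a, minimalPeriod σ a ≠ k}.ncard := by
  classical
  set S := {σ : Equiv.Perm (Fin n) | IsUnimodal σ ∧ ∀ a, minimalPeriod σ a ≠ k} with hS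
  have hpeak : ∀ σ : Equiv.Perm (Fin n), ∃ m : Fin n, σ ∈ S →
      StrictMonoOn σ (Set.Iic m) ∧ StrictAntiOn σ (Set.Ici m) := by
    intro σ
    by_cases hσ : σ ∈ S
    · obtain ⟨m, hm⟩ := hσ.1
      exact ⟨m, fun _ => hm⟩
    · exact ⟨0, fun h => absurd h hσ⟩
  choose m hm using hpeak
  have hcard : (S ×ˢ (Set.univ : Set Bool)).ncard = 2 * S.ncard := by
    rw [Set.ncard_prod, Set.ncard_univ, Nat.card_eq_fintype_card, Fintype.card_bool, mul_comm]
  rw [← hcard]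
  symm
  refine Set.ncard_congr (fun s _ => (s.1, if s.2 then fun a => decide (m s.1 < a)
    else fun a => decide (m s.1 ≤ a))) ?_ ?_ ?_
  · rintro ⟨σ, b⟩ ⟨hσ, -⟩
    obtain ⟨h1, h2⟩ := hm σ hσ
    refine ⟨?_, hσ.2⟩
    cases b
    · exact isTent_le_of_peak h1 h2
    · exact isTent_lt_of_peak h1 h2
  · rintro ⟨σ, b⟩ ⟨σ', b'⟩ - - h
    obtain ⟨h1, h2⟩ := Prod.ext_iff.1 h
    change σ = σ' at h1
    subst h1
    have h3 := congrFun h2 (m σ)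
    cases b <;> cases b' <;> simp at h3 ⊢
  · rintro ⟨σ, p⟩ ⟨hσ, hk⟩
    have hσS : σ ∈ S := ⟨hσ.isUnimodal, hk⟩
    obtain ⟨h1, h2⟩ := hm σ hσS
    rcases hσ.eq_lt_or_eq_le h1 h2 with h | h
    · exact ⟨(σ, true), ⟨hσS, Set.mem_univ _⟩, Prod.ext rfl h.symm⟩
    · exact ⟨(σ, false), ⟨hσS, Set.mem_univ _⟩, Prod.ext rfl h.symm⟩

lemma ncard_tents_of_isEmpty {k : ℕ} : (tents 0 k).ncard = 1 := by
  rw [← pow_zero 2, ← ncard_tents_zero 0]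
  congr 1
  ext s
  exact and_congr_right fun _ => ⟨fun _ a => a.elim0, fun _ a => a.elim0⟩

end Unimodal

/-! ### Cycle type and minimal periods -/

section CycleLength

lemma Equiv.Perm.card_support_cycleOf_eq_minimalPeriod {α : Type*} [Fintype α] [DecidableEq α]
    (σ : Equiv.Perm α) {a : α} (ha : a ∈ σ.support) :
    (σ.cycleOf a).support.card = minimalPeriod σ a := by
  rw [← Equiv.Perm.card_orbit_eq_minimalPeriod, ← Nat.card_eq_finsetCard]
  refine Nat.card_congr (Equiv.subtypeEquivRight fun b => ?_)
  rw [Equiv.Perm.mem_support_cycleOf_iff, and_iff_left ha, Quotient.eq]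
  exact Equiv.Perm.sameCycle_comm

lemma Equiv.Perm.mem_cycleType_iff_minimalPeriod {α : Type*} [Fintype α] [DecidableEq α]
    (σ : Equiv.Perm α) (k : ℕ) :
    k ∈ σ.cycleType ↔ ∃ a ∈ σ.support, minimalPeriod σ a = k := by
  rw [Equiv.Perm.cycleType_def, Multiset.mem_map]
  constructor
  · rintro ⟨c, hc, rfl⟩
    obtain ⟨a, ha⟩ := (Equiv.Perm.mem_cycleFactorsFinset_iff.1 hc).1.nonempty_support
    have haσ := Equiv.Perm.mem_cycleFactorsFinset_support_le hc ha
    refine ⟨a, haσ, ?_⟩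
    rw [← σ.card_support_cycleOf_eq_minimalPeriod haσ, ← Equiv.Perm.cycle_is_cycleOf ha hc]
    rfl
  · rintro ⟨a, ha, rfl⟩
    exact ⟨σ.cycleOf a, Equiv.Perm.cycleOf_mem_cycleFactorsFinset_iff.2 ha,
      σ.card_support_cycleOf_eq_minimalPeriod ha⟩

lemma hasCycleOfLength_iff {n : ℕ} (σ : Equiv.Perm (Fin n)) (k : ℕ) :
    HasCycleOfLength σ k ↔ ∃ a, minimalPeriod σ a = k := by
  have hfix : ∀ a, a ∉ σ.support ↔ minimalPeriod σ a = 1 := fun a => by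
    rw [Equiv.Perm.notMem_support, minimalPeriod_eq_one_iff_isFixedPt, IsFixedPt]
  rw [HasCycleOfLength, Equiv.Perm.parts_partition, Multiset.mem_add,
    Equiv.Perm.mem_cycleType_iff_minimalPeriod, Multiset.mem_replicate]
  constructor
  · rintro (⟨a, -, ha⟩ | ⟨hcard, rfl⟩)
    · exact ⟨a, ha⟩
    · by_contra! h
      apply hcard
      have : σ.support = Finset.univ :=
        Finset.eq_univ_of_forall fun a => by_contra fun ha => h a ((hfix a).1 ha)
      rw [this, Finset.card_univ, Nat.sub_self]
  · rintro ⟨a, ha⟩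
    by_cases hs : a ∈ σ.support
    · exact Or.inl ⟨a, hs, ha⟩
    · refine Or.inr ⟨?_, ha.symm.trans ((hfix a).1 hs)⟩
      have := Finset.card_lt_univ_of_notMem hs
      omega

lemma hasCycleOfLength_one_iff {n : ℕ} (σ : Equiv.Perm (Fin n)) :
    HasCycleOfLength σ 1 ↔ ∃ a, σ a = a := by
  simp only [hasCycleOfLength_iff, minimalPeriod_eq_one_iff_isFixedPt, IsFixedPt]

lemma ncard_tents_eq_two_mul_numUnimodalNoCycle {n : ℕ} (hn : 1 ≤ n) (k : ℕ) :
    (tents n k).ncard = 2 * numUnimodalNoCycle n k := by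
  have : NeZero n := ⟨by omega⟩
  rw [ncard_tents_eq_two_mul, numUnimodalNoCycle]
  simp only [hasCycleOfLength_iff, not_exists, ne_eq]

end CycleLength

/-! ### The generating function -/

section GeneratingFunction

open PowerSeries

lemma PowerSeries.coeff_mul_congr {R : Type*} [Semiring R] {φ φ' : PowerSeries R}
    (ψ : PowerSeries R) {n : ℕ} (h : ∀ m ≤ n, coeff m φ = coeff m φ') :
    coeff n (φ * ψ) = coeff n (φ' * ψ) := by
  rw [coeff_mul, coeff_mul]
  refine Finset.sum_congr rfl fun a ha => ?_
  rw [h _ (by have := Finset.HasAntidiagonal.mem_antidiagonal.1 ha; omega)]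

lemma mk_ncard_tents_mul {k : ℕ} (hk : 1 ≤ k) {c : ℕ} (hc : (c : ℚ) = cycleExponent k) :
    (PowerSeries.mk fun n => ((tents n k).ncard : ℚ)) * (1 + X ^ k) ^ c =
      (PowerSeries.mk fun n => (2 ^ n : ℚ)) * (1 - X ^ k) ^ c := by
  ext n
  -- No single `L` serves all degrees. This `L` is a multiple of `k` and of every `m!` with `m ≤ n`,
  -- which is enough for the coefficient of degree `n`; the exponent does not depend on it, being
  -- `cycleExponent k`.
  have : NeZero (k * n.factorial) := ⟨by have := n.factorial_ne_zero; positivity⟩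
  obtain ⟨c', hc', V, U, hV, hU, h⟩ :=
    PeriodicSeq.exists_coeff_tents_eq (L := k * n.factorial) hk (dvd_mul_right _ _)
  obtain rfl : c' = c := by rw [← hc] at hc'; exact_mod_cast hc'
  have hdvd : ∀ m ≤ n, m.factorial ∣ k * n.factorial := fun m hm =>
    (Nat.factorial_dvd_factorial hm).mul_left _
  rw [PowerSeries.coeff_mul_congr (φ' := V) _ fun m hm => by rw [coeff_mk, hV m (hdvd m hm)], h]
  refine PowerSeries.coeff_mul_congr _ fun m hm => ?_
  rw [coeff_mk, hU m (hdvd m hm), ncard_tents_zero]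
  push_cast
  rfl

lemma mk_two_pow_mul : (PowerSeries.mk fun n => (2 ^ n : ℚ)) * (1 - 2 * X) = 1 := by
  ext n
  have h2 : (2 * X : PowerSeries ℚ) = C 2 * X := by rw [map_ofNat]
  rw [mul_sub, mul_one, h2, mul_left_comm, map_sub, coeff_C_mul, coeff_mk, coeff_one]
  cases n with
  | zero => simp
  | succ n => rw [coeff_succ_mul_X, coeff_mk, if_neg n.succ_ne_zero]; ring

lemma exists_natCast_eq_cycleExponent {k : ℕ} (hk : 1 ≤ k) :
    ∃ c : ℕ, (c : ℚ) = cycleExponent k := by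
  have : NeZero k := ⟨by omega⟩
  obtain ⟨c, hc, -⟩ := PeriodicSeq.exists_coeff_tents_eq (L := k) hk dvd_rfl
  exact ⟨c, hc⟩

lemma one_add_two_mul_mk_eq (k : ℕ) :
    (1 + 2 * PowerSeries.mk
      (fun n : ℕ => if 1 ≤ n then (numUnimodalNoCycle n k : ℚ) else 0) : PowerSeries ℚ) =
      PowerSeries.mk fun n => ((tents n k).ncard : ℚ) := by
  ext n
  have h2 : (2 : PowerSeries ℚ) = C 2 := by rw [map_ofNat]
  rw [h2, map_add, coeff_C_mul, coeff_mk, coeff_mk, coeff_one]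
  rcases Nat.eq_zero_or_pos n with rfl | hn
  -- In degree 0 there is one empty tent rather than two, which accounts for the summand 1.
  · simp [ncard_tents_of_isEmpty]
  · rw [if_neg hn.ne', if_pos (show 1 ≤ n from hn), ncard_tents_eq_two_mul_numUnimodalNoCycle hn]
    push_cast
    ring

lemma numUnimodalNoCycle_one {n : ℕ} (hn : 1 ≤ n) :
    (numUnimodalNoCycle n 1 : ℚ) = (2 ^ (n - 1) + (-1) ^ n) / 3 := by
  have hc : ((1 : ℕ) : ℚ) = cycleExponent 1 := by
    simp [cycleExponent, Finset.filter_singleton]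
  have h := mk_ncard_tents_mul le_rfl hc
  simp only [pow_one] at h
  -- Coefficients of `V * (1 + t) = U * (1 - t)` in degree `m + 1`, with `2^(m+1) - 2^m = 2^m` on
  -- the right.
  have hrec : ∀ m, ((tents (m + 1) 1).ncard : ℚ) + (tents m 1).ncard = 2 ^ m := by
    intro m
    have := congrArg (coeff (m + 1)) h
    rw [mul_add, mul_sub, mul_one, mul_one, map_add, map_sub, coeff_succ_mul_X,
      coeff_succ_mul_X] at this
    simp only [coeff_mk] at this
    rw [this]; ring
  have hclosed : ∀ m, ((tents m 1).ncard : ℚ) = (2 ^ m + 2 * (-1) ^ m) / 3 := by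
    intro m
    induction m with
    | zero => rw [ncard_tents_of_isEmpty]; norm_num
    | succ m ih =>
      have := hrec m
      rw [ih] at this
      rw [eq_sub_of_add_eq this]
      ring
  obtain ⟨m, rfl⟩ := Nat.exists_eq_add_of_le' hn
  have h1 := hclosed (m + 1)
  rw [ncard_tents_eq_two_mul_numUnimodalNoCycle hn] at h1
  push_cast at h1
  rw [Nat.add_sub_cancel]
  have h2 : (2 : ℚ) ^ (m + 1) = 2 * 2 ^ m := pow_succ' _ _
  rw [h2] at h1
  linarith

end GeneratingFunction

open PowerSeries in
theorem corollary2 :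
    (∀ k : ℕ, 1 ≤ k →
      ∃ c : ℕ, (c : ℚ) = cycleExponent k ∧
        (1 + 2 * PowerSeries.mk
            (fun n : ℕ => if 1 ≤ n then (numUnimodalNoCycle n k : ℚ) else 0) : PowerSeries ℚ) =
          ((1 - X ^ k) * (1 + X ^ k)⁻¹) ^ c * (1 - 2 * X)⁻¹) ∧
    (∀ n : ℕ, 1 ≤ n →
      (numUnimodalNoCycle n 1 : ℚ) = (2 ^ (n - 1) + (-1) ^ n) / 3 ∧
      ({σ : Equiv.Perm (Fin n) | IsUnimodal σ ∧ σ ∈ derangements (Fin n)}.ncard : ℚ) =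
        (2 ^ (n - 1) + (-1) ^ n) / 3) := by
  refine ⟨fun k hk => ?_, fun n hn => ⟨numUnimodalNoCycle_one hn, ?_⟩⟩
  · obtain ⟨c, hc⟩ := exists_natCast_eq_cycleExponent hk
    refine ⟨c, hc, ?_⟩
    rw [one_add_two_mul_mk_eq, PowerSeries.eq_mul_inv_iff_mul_eq (by simp)]
    have hinv : (1 + X ^ k : PowerSeries ℚ) * (1 + X ^ k)⁻¹ = 1 :=
      PowerSeries.mul_inv_cancel _ (by
        have hk0 : k ≠ 0 := by omega
        simp [hk0])
    have hinv' : (1 + X ^ k : PowerSeries ℚ) ^ c * (1 + X ^ k)⁻¹ ^ c = 1 := by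
      rw [← mul_pow, hinv, one_pow]
    have h1 := mk_ncard_tents_mul hk hc
    have h2 := mk_two_pow_mul
    generalize (1 + X ^ k : PowerSeries ℚ)⁻¹ = B at *
    rw [mul_pow]
    set V := PowerSeries.mk fun n => ((tents n k).ncard : ℚ)
    set U := PowerSeries.mk fun n => (2 ^ n : ℚ)
    calc V * (1 - 2 * X) = V * (1 - 2 * X) * ((1 + X ^ k) ^ c * B ^ c) := by
          rw [hinv', mul_one]
      _ = (V * (1 + X ^ k) ^ c) * ((1 - 2 * X) * B ^ c) := by ring
      _ = (1 - X ^ k) ^ c * B ^ c * (U * (1 - 2 * X)) := by rw [h1]; ring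
      _ = (1 - X ^ k) ^ c * B ^ c := by rw [h2, mul_one]
  · rw [← numUnimodalNoCycle_one hn, numUnimodalNoCycle]
    simp only [hasCycleOfLength_one_iff, not_exists]
    rfl
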